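/- Let $n\ge 1$, let $\gamma:[0,1]\to\mathbb{R}^n$ be a non-degenerate $C^n$ curve, that is, $\det(\gamma'(t),\gamma''(t),\dots,\gamma^{(n)}(t))\neq 0$ for every $t\in[0,1]$, and fix a real number $E>n$. For an interval $I\subset[0,1]$ and $f\in L^1([0,1])$ (complex-valued) put $$E_If(x)=\int_I e^{2\pi i x\cdot\gamma(t)}f(t)\,dt\qquad(x\in\mathbb{R}^n).$$ For a ball $B\subset\mathbb{R}^n$ with centre $x_0$ and radius $\rho>0$ let $w_B(x)=(1+\rho^{-1}|x-x_0|)^{-E}$, and write $\|F\|_{L^p(w_B)}=\big(\int_{\mathbb{R}^n}|F(x)|^p\,w_B(x)\,dx\big)^{1/p}$. For $R\ge 1$ dissect $[0,1]$ into the intervals $I=[\ell R^{-1},(\ell+1)R^{-1}]\cap[0,1]$, where $\ell$ runs over the integers with $0\le\ell<R$ (so every interval has length $R^{-1}$, except that the last one is shorter if $R$ is not an integer); $\sum_{|I|=R^{-1}}$ denotes the sum over these intervals. Then there is a constant $C\in(0,\infty)$, depending only on $\gamma$, $n$ and the fixed exponent $E$, such that for every integer $1\le m\le n$, every $R\ge1$,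 every ball $B\subset\mathbb{R}^n$ of radius at least $R^n$ and every $f\in L^1([0,1])$, $$\|E_{[0,1]}f\|_{L^{2m}(w_B)}\le C\,\Big\|\Big(\sum_{|I|=R^{-1}}|E_If|^2\Big)^{1/2}\Big\|_{L^{2m}(w_B)},$$ and consequently ($\ell^2$ decoupling for the even exponents $p=2m\le 2n$) $$\|E_{[0,1]}f\|_{L^{2m}(w_B)}\le C\,\Big(\sum_{|I|=R^{-1}}\|E_If\|_{L^{2m}(w_B)}^2\Big)^{1/2}.$$ -/

import Mathlib

open MeasureTheory Set

noncomputable section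

/-- `γ : [0,1] → ℝⁿ` is a `Cⁿ` curve (only the values of `γ` on `[0,1]` matter; derivatives at the
endpoints are one-sided) with `det (γ'(t), γ''(t), …, γ⁽ⁿ⁾(t)) ≠ 0` for every `t ∈ [0,1]`. -/
structure IsNondegenerateCurve {n : ℕ} (γ : ℝ → EuclideanSpace ℝ (Fin n)) : Prop where
  contDiffOn : ContDiffOn ℝ (n : WithTop ℕ∞) γ (Icc 0 1)
  det_ne_zero : ∀ t ∈ Icc (0 : ℝ) 1,
    (Matrix.of fun i j : Fin n =>
      iteratedDerivWithin ((j : ℕ) + 1) γ (Icc 0 1) t i).det ≠ 0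

/-- The Fourier extension operator `E_I f(x) = ∫_I e^{2πi x·γ(t)} f(t) dt`. -/
def extensionOp {n : ℕ} (γ : ℝ → EuclideanSpace ℝ (Fin n)) (I : Set ℝ) (f : ℝ → ℂ)
    (x : EuclideanSpace ℝ (Fin n)) : ℂ :=
  ∫ t in I, Complex.exp (2 * Real.pi * Complex.I * (inner ℝ x (γ t) : ℝ)) * f t

/-- The weight `w_B(x) = (1 + ρ⁻¹ |x - x₀|)^{-E}` of the ball `B` with centre `x₀` and
radius `ρ`. -/
def ballWeight {n : ℕ} (E : ℝ) (x₀ : EuclideanSpace ℝ (Fin n)) (ρ : ℝ)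
    (x : EuclideanSpace ℝ (Fin n)) : ℝ :=
  (1 + ρ⁻¹ * ‖x - x₀‖) ^ (-E)

/-- The weighted norm `‖F‖_{L^p(v)} = (∫ |F(x)|^p v(x) dx)^{1/p}`, as an extended non-negative
number: the `L^p` norm with respect to the measure `v(x) dx`. -/
def weightedLpNorm {n : ℕ} {G : Type*} [NormedAddCommGroup G]
    (F : EuclideanSpace ℝ (Fin n) → G) (p : ENNReal)
    (v : EuclideanSpace ℝ (Fin n) → ℝ) : ENNReal :=
  eLpNorm F p (volume.withDensity fun x => ENNReal.ofReal (v x))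

/-- The `ℓ`-th interval `[ℓ/R, (ℓ+1)/R] ∩ [0,1]` of the dissection of `[0,1]` into intervals of
length `R⁻¹`. The indices are the integers `0 ≤ ℓ < R`, that is, `ℓ ∈ Finset.range ⌈R⌉₊`; if `R`
is not an integer, the last interval is shorter. -/
def dissectionInterval (R : ℝ) (l : ℕ) : Set ℝ :=
  Icc ((l : ℝ) / R) (((l : ℝ) + 1) / R) ∩ Icc 0 1

/-- The square function `(∑_{|I| = R⁻¹} |E_I f(x)|²)^{1/2}`. -/
def squareFunction {n : ℕ} (γ : ℝ → EuclideanSpace ℝ (Fin n)) (R : ℝ) (f : ℝ → ℂ)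
    (x : EuclideanSpace ℝ (Fin n)) : ℝ :=
  Real.sqrt (∑ l ∈ Finset.range ⌈R⌉₊, ‖extensionOp γ (dissectionInterval R l) f x‖ ^ 2)

end

/-! Expand `|E f|^(2m)` into products over pairs of `m`-tuples of intervals and integrate against a
weight whose Fourier transform lives in a ball of radius `r/ρ`, which is at most `r * R^(-n)`. A
product can contribute only if some points of its intervals satisfy `|∑ γ(t_i) - ∑ γ(s_i)| < r/ρ`.

The heart is `IsNondegenerateCurve.exists_matching`: for `m ≤ n` points in a short interval, this
forces the `s_i` to be a permutation of the `t_i` up to errors `O(1/R)`. Sort both tuples. The signs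
of `t_i - s_i` change at fewer than `n` places, and nondegeneracy supplies a unit vector `v` such
that `v · γ'` changes sign exactly there. Then all the terms `v · (γ(t_i) - γ(s_i))` have the same
sign, nothing cancels in their sum, and each is bounded below by a power of `|t_i - s_i|`.

So only nearly permuted tuples survive, and their sum is bounded pointwise by a multiple of the
`m`-th power of `∑ |E_I f|^2` (`integral_norm_sum_pow_le_of_orthogonal`). Cutting `[0,1]` into
boundedly many short pieces removes the restriction to short intervals. Averaging over translates of
the band-limited weight yields the weight of the ball (`lintegral_ballWeight_mul_le`), and
Minkowski's inequality turns the square function estimate into decoupling. -/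

/-! ### Rolle's theorem and the remainder of Lagrange interpolation -/

/-- Rolle in each gap between consecutive points of `Z`; the open gaps are disjoint, so the zeros
found are distinct and only one zero is lost. -/
theorem exists_finset_deriv_zeros {g g' : ℝ → ℝ} {a b : ℝ}
    (hg : ∀ u ∈ Icc a b, HasDerivWithinAt g (g' u) (Icc a b) u) {Z : Finset ℝ}
    (hZ : ↑Z ⊆ Icc a b) (hz : ∀ z ∈ Z, g z = 0) {p : ℕ} (hp : Z.card = p + 1) :
    ∃ Z' : Finset ℝ, ↑Z' ⊆ Icc a b ∧ (∀ z ∈ Z', g' z = 0) ∧ Z'.card = p := by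
  have key : ∀ i : Fin p, ∃ ξ, ξ ∈ Ioo (Z.orderEmbOfFin hp i.castSucc) (Z.orderEmbOfFin hp i.succ) ∧
      g' ξ = 0 := by
    intro i
    set x := Z.orderEmbOfFin hp i.castSucc
    set y := Z.orderEmbOfFin hp i.succ
    have hx := hZ (Z.orderEmbOfFin_mem hp i.castSucc)
    have hy := hZ (Z.orderEmbOfFin_mem hp i.succ)
    have hxy : x < y := (Z.orderEmbOfFin hp).strictMono Fin.castSucc_lt_succ
    have hsub : Icc x y ⊆ Icc a b := Icc_subset_Icc hx.1 hy.2
    obtain ⟨ξ, h1, h2⟩ := exists_hasDerivAt_eq_zero (f := g) (f' := g') hxy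
      (fun u hu => ((hg u (hsub hu)).continuousWithinAt).mono hsub)
      (by rw [hz _ (Z.orderEmbOfFin_mem hp i.castSucc), hz _ (Z.orderEmbOfFin_mem hp i.succ)])
      (fun u hu => (hg u (hsub (Ioo_subset_Icc_self hu))).hasDerivAt
        (Icc_mem_nhds (hx.1.trans_lt hu.1) (hu.2.trans_le hy.2)))
    exact ⟨ξ, h1, h2⟩
  choose ξ hξ hξ0 using key
  have hmono : StrictMono ξ := by
    intro i j hij
    refine (hξ i).2.trans_le (le_trans ?_ (hξ j).1.le)
    exact (Z.orderEmbOfFin hp).monotone (Fin.succ_le_castSucc_iff.2 hij)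
  refine ⟨Finset.univ.image ξ, ?_, ?_, ?_⟩
  · intro u hu
    simp only [Finset.coe_image, Finset.coe_univ, image_univ, mem_range] at hu
    obtain ⟨i, rfl⟩ := hu
    exact ⟨(hZ (Z.orderEmbOfFin_mem hp i.castSucc)).1.trans (hξ i).1.le,
      (hξ i).2.le.trans (hZ (Z.orderEmbOfFin_mem hp i.succ)).2⟩
  · intro z hz
    simp only [Finset.mem_image, Finset.mem_univ, true_and] at hz
    obtain ⟨i, rfl⟩ := hz
    exact hξ0 i
  · rw [Finset.card_image_of_injective _ hmono.injective, Finset.card_univ, Fintype.card_fin]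

theorem exists_finset_iterated_deriv_zeros {g : ℕ → ℝ → ℝ} {a b : ℝ} {Z : Finset ℝ}
    (hZ : ↑Z ⊆ Icc a b) (hz : ∀ z ∈ Z, g 0 z = 0) (k p : ℕ)
    (hg : ∀ i < k, ∀ u ∈ Icc a b, HasDerivWithinAt (g i) (g (i + 1) u) (Icc a b) u)
    (hp : Z.card = p + k) :
    ∃ Z' : Finset ℝ, ↑Z' ⊆ Icc a b ∧ (∀ z ∈ Z', g k z = 0) ∧ Z'.card = p := by
  induction k generalizing p with
  | zero => exact ⟨Z, hZ, hz, hp⟩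
  | succ k ih =>
    obtain ⟨Z', h1, h2, h3⟩ := ih (p + 1) (fun i hi => hg i (hi.trans k.lt_succ_self)) (by omega)
    exact exists_finset_deriv_zeros (hg k k.lt_succ_self) h1 h2 h3

theorem exists_iterated_deriv_eq_zero {g : ℕ → ℝ → ℝ} {a b : ℝ} {Z : Finset ℝ}
    (hZ : ↑Z ⊆ Icc a b) (hz : ∀ z ∈ Z, g 0 z = 0) (k : ℕ)
    (hg : ∀ i < k, ∀ u ∈ Icc a b, HasDerivWithinAt (g i) (g (i + 1) u) (Icc a b) u)
    (hk : k < Z.card) : ∃ ξ ∈ Icc a b, g k ξ = 0 := by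
  obtain ⟨Z', h1, h2, h3⟩ := exists_finset_iterated_deriv_zeros hZ hz k (Z.card - k) hg (by omega)
  obtain ⟨ξ, hξ⟩ : Z'.Nonempty := Finset.card_pos.1 (by omega)
  exact ⟨ξ, h1 hξ, h2 ξ hξ⟩

theorem iterate_derivative_prod_X_sub_C (Z : Finset ℝ) (x : ℝ) :
    ((Polynomial.derivative^[Z.card]) (∏ z ∈ Z, (Polynomial.X - Polynomial.C z))).eval x =
      (Z.card.factorial : ℝ) := by
  have hm : (∏ z ∈ Z, (Polynomial.X - Polynomial.C z)).Monic :=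
    Polynomial.monic_prod_of_monic _ _ fun z _ => Polynomial.monic_X_sub_C z
  have hd : (∏ z ∈ Z, (Polynomial.X - Polynomial.C z)).natDegree = Z.card := by
    simp
  have h0 : ((Polynomial.derivative^[Z.card])
      (∏ z ∈ Z, (Polynomial.X - Polynomial.C z))).natDegree = 0 := by
    have := Polynomial.natDegree_iterate_derivative
      (∏ z ∈ Z, (Polynomial.X - Polynomial.C z)) Z.card
    omega
  rw [Polynomial.eq_C_of_natDegree_eq_zero h0, Polynomial.eval_C,
    Polynomial.coeff_iterate_derivative]
  have : (∏ z ∈ Z, (Polynomial.X - Polynomial.C z)).coeff (0 + Z.card) = 1 := by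
    rw [zero_add, ← hd]; exact hm
  rw [this]
  simp [Nat.descFactorial_self]

/-- The error formula of Lagrange interpolation at the zeros of `g 0`. -/
theorem exists_factorial_mul_eq_iterated_deriv_mul_prod {g : ℕ → ℝ → ℝ} {a b : ℝ} {Z : Finset ℝ}
    (hZ : ↑Z ⊆ Icc a b) (hz : ∀ z ∈ Z, g 0 z = 0)
    (hg : ∀ i < Z.card, ∀ u ∈ Icc a b, HasDerivWithinAt (g i) (g (i + 1) u) (Icc a b) u)
    {u : ℝ} (hu : u ∈ Icc a b) :
    ∃ ξ ∈ Icc a b, (Z.card.factorial : ℝ) * g 0 u = g Z.card ξ * ∏ z ∈ Z, (u - z) := by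
  classical
  by_cases huZ : u ∈ Z
  · exact ⟨u, hu, by rw [hz u huZ, Finset.prod_eq_zero huZ (sub_self u)]; simp⟩
  set P : Polynomial ℝ := ∏ z ∈ Z, (Polynomial.X - Polynomial.C z) with hP
  have hPe : ∀ x, P.eval x = ∏ z ∈ Z, (x - z) := by
    intro x; rw [hP, Polynomial.eval_prod]; simp
  have hPu : P.eval u ≠ 0 := by
    rw [hPe]
    exact Finset.prod_ne_zero_iff.2 fun z hz h => huZ (by rwa [sub_eq_zero.1 h])
  -- With this `l`, the function `g 0 - l * P` vanishes at `u` as well as on `Z`, so its derivative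
  -- of order `Z.card` has a zero; that derivative of the monic `P` is a factorial.
  set l : ℝ := g 0 u / P.eval u with hl
  obtain ⟨ξ, hξ, h0⟩ := exists_iterated_deriv_eq_zero
    (g := fun k x => g k x - l * ((Polynomial.derivative^[k]) P).eval x) (Z := insert u Z)
    (a := a) (b := b)
    (by rw [Finset.coe_insert]; exact insert_subset hu hZ)
    (by
      intro z hz'
      rcases Finset.mem_insert.1 hz' with rfl | hz'
      · simp [hl, hPu]
      · have : P.eval z = 0 := by rw [hPe, Finset.prod_eq_zero hz' (sub_self z)]
        simp [hz z hz', this]) Z.card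
    (by
      intro i hi x hx
      refine (hg i hi x hx).sub ?_
      rw [Function.iterate_succ_apply']
      exact ((Polynomial.hasDerivAt _ x).const_mul l).hasDerivWithinAt)
    (by rw [Finset.card_insert_of_notMem huZ]; exact Nat.lt_succ_self _)
  refine ⟨ξ, hξ, ?_⟩
  simp only [hP, iterate_derivative_prod_X_sub_C] at h0
  rw [← hPe, sub_eq_zero.1 h0, hl]
  field_simp

/-! ### Sign changes between two sorted sequences -/

/-- Induction on the number `k` of indices treated. Here `j` is the last index with `t j ≠ s j` and
`e` the sign of its difference. The points of `Z` lie to the left of the `j`-th interval, so the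
product is nonnegative from there on. A point is added only when `j` advances, whence `Z.card ≤ j`.
-/
theorem exists_sign_change_points_aux {t s : ℕ → ℝ} {m : ℕ}
    (ht : ∀ i j, i ≤ j → j < m → t i ≤ t j) (hs : ∀ i j, i ≤ j → j < m → s i ≤ s j) {a b : ℝ}
    (hta : ∀ i < m, t i ∈ Icc a b) (hsa : ∀ i < m, s i ∈ Icc a b) (k : ℕ) (hk : k ≤ m) :
    (∀ i < k, t i = s i) ∨ ∃ j < k, ∃ (Z : Finset ℝ) (e : ℝ), Z.card ≤ j ∧ (e = 1 ∨ e = -1) ∧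
      0 < e * (t j - s j) ∧ (∀ z ∈ Z, z ∈ Icc a b ∧ z ≤ min (s j) (t j)) ∧
      (∀ i < k, t i ≠ s i → i ≤ j) ∧
      ∀ i ≤ j, ∀ u ∈ uIcc (s i) (t i), 0 ≤ e * (t i - s i) * ∏ z ∈ Z, (u - z) := by
  classical
  induction k with
  | zero => left; intro i hi; omega
  | succ k ih =>
    have ihk := ih (by omega)
    by_cases hd : t k = s k
    · rcases ihk with h | ⟨j, hj, Z, e, h1, h2, h3, h4, h5, h6⟩
      · left
        intro i hi
        rcases Nat.lt_succ_iff_lt_or_eq.1 hi with h' | rfl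
        exacts [h i h', hd]
      · refine Or.inr ⟨j, by omega, Z, e, h1, h2, h3, h4, ?_, h6⟩
        intro i hi hne
        rcases Nat.lt_succ_iff_lt_or_eq.1 hi with h' | rfl
        exacts [h5 i h' hne, absurd hd hne]
    right
    obtain ⟨e', he', hpos⟩ : ∃ e : ℝ, (e = 1 ∨ e = -1) ∧ 0 < e * (t k - s k) := by
      rcases lt_or_gt_of_ne hd with h | h
      · exact ⟨-1, Or.inr rfl, by linarith⟩
      · exact ⟨1, Or.inl rfl, by linarith⟩
    rcases ihk with h | ⟨j, hj, Z, e, h1, h2, h3, h4, h5, h6⟩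
    · refine ⟨k, by omega, ∅, e', by simp, he', hpos, by simp, fun i hi _ => by omega, ?_⟩
      intro i hi u _
      rw [Finset.prod_empty, mul_one]
      rcases Nat.lt_or_eq_of_le hi with h' | rfl
      · rw [h i h']; simp
      · exact hpos.le
    have htj : t j ≤ t k := ht j k hj.le (by omega)
    have hsj : s j ≤ s k := hs j k hj.le (by omega)
    have hmin : min (s j) (t j) ≤ min (s k) (t k) := min_le_min hsj htj
    have hdeg : ∀ i < k, j < i → t i = s i := by
      intro i hi hji
      by_contra hne
      exact absurd (h5 i hi hne) (by omega)
    by_cases hee : e = e'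
    · subst hee
      refine ⟨k, by omega, Z, e, by omega, h2, hpos,
        fun z hz => ⟨(h4 z hz).1, (h4 z hz).2.trans hmin⟩, fun i hi _ => by omega, ?_⟩
      intro i hi u hu
      rcases Nat.lt_or_eq_of_le hi with h' | rfl
      · by_cases hij : i ≤ j
        · exact h6 i hij u hu
        · rw [hdeg i h' (by omega)]; simp
      · refine mul_nonneg hpos.le (Finset.prod_nonneg fun z hz => ?_)
        linarith [hu.1, (h4 z hz).2]
    · have hneg : e' = -e := by
        rcases h2 with rfl | rfl <;> rcases he' with rfl | rfl <;>
          first | exact absurd rfl hee | norm_num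
      -- When the sign flips, monotonicity separates the `j`-th interval from the `k`-th. The right
      -- end of the former is the new zero: it reverses the product on all earlier intervals, in
      -- step with `e' = -e`, and keeps it nonnegative on the `k`-th.
      have hM : max (s j) (t j) ≤ min (s k) (t k) := by
        rcases h2 with rfl | rfl <;> subst hneg
        · rw [max_eq_right (by linarith), min_eq_right (by linarith)]; exact htj
        · rw [max_eq_left (by linarith), min_eq_left (by linarith)]; exact hsj
      have hlt : min (s j) (t j) < max (s j) (t j) := by
        refine min_lt_max.2 fun h => ?_
        rw [h] at h3; simp at h3
      have hnot : max (s j) (t j) ∉ Z := fun h => absurd (h4 _ h).2 (not_le.2 hlt)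
      have hjm : j < m := by omega
      refine ⟨k, by omega, insert (max (s j) (t j)) Z, e', ?_, he', hpos, ?_,
        fun i hi _ => by omega, ?_⟩
      · rw [Finset.card_insert_of_notMem hnot]; omega
      · intro z hz
        rcases Finset.mem_insert.1 hz with rfl | hz
        · exact ⟨⟨le_max_of_le_left (hsa j hjm).1, max_le (hsa j hjm).2 (hta j hjm).2⟩, hM⟩
        · exact ⟨(h4 z hz).1, (h4 z hz).2.trans hmin⟩
      · intro i hi u hu
        rw [Finset.prod_insert hnot]
        rcases Nat.lt_or_eq_of_le hi with h' | rfl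
        · by_cases hij : i ≤ j
          · have hle : u ≤ max (s j) (t j) :=
              hu.2.trans (max_le_max (hs i j hij hjm) (ht i j hij hjm))
            have := mul_nonneg (h6 i hij u hu) (sub_nonneg.2 hle)
            rw [hneg]
            linarith
          · rw [hdeg i h' (by omega)]; simp
        · refine mul_nonneg hpos.le (mul_nonneg ?_ (Finset.prod_nonneg fun z hz => ?_))
          · linarith [hu.1]
          · linarith [hu.1, (h4 z hz).2]

/-- For two increasing sequences of length `m`, there are fewer than `m` points such that the
polynomial vanishing at them has, on the interval between `s i` and `t i`, the sign of `t i - s i`,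
up to a common sign. -/
theorem exists_sign_change_points {t s : ℕ → ℝ} {m : ℕ} (hm : 1 ≤ m)
    (ht : ∀ i j, i ≤ j → j < m → t i ≤ t j) (hs : ∀ i j, i ≤ j → j < m → s i ≤ s j) {a b : ℝ}
    (hta : ∀ i < m, t i ∈ Icc a b) (hsa : ∀ i < m, s i ∈ Icc a b) :
    ∃ (Z : Finset ℝ) (e : ℝ), ↑Z ⊆ Icc a b ∧ Z.card < m ∧ (e = 1 ∨ e = -1) ∧
      ∀ i < m, ∀ u ∈ uIcc (s i) (t i), 0 ≤ e * (t i - s i) * ∏ z ∈ Z, (u - z) := by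
  rcases exists_sign_change_points_aux ht hs hta hsa m le_rfl with
    h | ⟨j, hj, Z, e, h1, h2, h3, h4, h5, h6⟩
  · refine ⟨∅, 1, by simp, by simpa using Nat.lt_of_lt_of_le Nat.zero_lt_one hm, Or.inl rfl, ?_⟩
    intro i hi u _
    rw [h i hi]; simp
  · refine ⟨Z, e, fun z hz => (h4 z hz).1, by omega, h2, ?_⟩
    intro i hi u hu
    by_cases hij : i ≤ j
    · exact h6 i hij u hu
    · have : t i = s i := by
        by_contra hne
        exact hij (h5 i hi hne)
      rw [this]; simp

/-! ### Growth forced by a derivative bounded below by a polynomial -/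

/-- For each point in turn, keep the outer quarter of the current interval on the side away from the
point; every point of that quarter is at least a quarter length away from it. -/
theorem exists_subinterval_prod_ge (Z : Finset ℝ) {x y : ℝ} (hxy : x ≤ y) :
    ∃ x' y', x ≤ x' ∧ x' ≤ y' ∧ y' ≤ y ∧ y' - x' = (y - x) / 4 ^ Z.card ∧
      ∀ z ∈ Z, ∀ u ∈ Icc x' y', (y - x) / 4 ^ Z.card ≤ |u - z| := by
  classical
  induction Z using Finset.induction_on with
  | empty => exact ⟨x, y, le_rfl, hxy, le_rfl, by simp, by simp⟩
  | insert z Z hz ih =>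
    obtain ⟨x', y', h1, h2, h3, h4, h5⟩ := ih
    rw [Finset.card_insert_of_notMem hz, pow_succ, ← div_div, ← h4]
    have h0 : 0 ≤ y' - x' := sub_nonneg.2 h2
    by_cases hmid : (x' + y') / 2 ≤ z
    · refine ⟨x', x' + (y' - x') / 4, h1, by linarith, by linarith, by ring, ?_⟩
      intro w hw u hu
      rcases Finset.mem_insert.1 hw with rfl | hw
      · rw [abs_sub_comm, abs_of_nonneg] <;> linarith [hu.2]
      · have := h5 w hw u ⟨hu.1, by linarith [hu.2]⟩
        linarith
    · refine ⟨y' - (y' - x') / 4, y', by linarith, by linarith, h3, by ring, ?_⟩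
      intro w hw u hu
      rcases Finset.mem_insert.1 hw with rfl | hw
      · rw [abs_of_nonneg] <;> linarith [hu.1]
      · have := h5 w hw u ⟨by linarith [hu.1], hu.2⟩
        linarith

/-- A function whose derivative has a fixed sign and dominates a polynomial with leading
coefficient `c` increases by at least a multiple of the power of the length of the interval. -/
theorem sub_ge_of_deriv_ge_prod {G g : ℝ → ℝ} {x y c : ℝ} (hxy : x ≤ y) (hc : 0 ≤ c)
    (hG : ∀ u ∈ Icc x y, HasDerivWithinAt G (g u) (Icc x y) u) (Z : Finset ℝ)
    (hg : ∀ u ∈ Icc x y, c * ∏ z ∈ Z, |u - z| ≤ g u) :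
    c * ((y - x) / 4 ^ Z.card) ^ (Z.card + 1) ≤ G y - G x := by
  obtain ⟨x', y', h1, h2, h3, h4, h5⟩ := exists_subinterval_prod_ge Z hxy
  have hcont : ContinuousOn G (Icc x y) := fun u hu => (hG u hu).continuousWithinAt
  have hder : ∀ u ∈ interior (Icc x y), HasDerivAt G (g u) u := by
    intro u hu
    rw [interior_Icc] at hu
    exact (hG u (Ioo_subset_Icc_self hu)).hasDerivAt (Icc_mem_nhds hu.1 hu.2)
  have hmono : MonotoneOn G (Icc x y) := by
    refine monotoneOn_of_deriv_nonneg (convex_Icc x y) hcont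
      (fun u hu => (hder u hu).differentiableAt.differentiableWithinAt) fun u hu => ?_
    rw [(hder u hu).deriv]
    exact le_trans (mul_nonneg hc (Finset.prod_nonneg fun _ _ => abs_nonneg _))
      (hg u (interior_subset hu))
  have hL : 0 ≤ (y - x) / 4 ^ Z.card := by
    have := sub_nonneg.2 hxy
    positivity
  have hsub : Icc x' y' ⊆ Icc x y := Icc_subset_Icc h1 h3
  -- All the growth is collected on `[x', y']`, where the product is large; on the rest monotonicity
  -- is enough.
  have key := Convex.mul_sub_le_image_sub_of_le_deriv (convex_Icc x' y') (hcont.mono hsub)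
    (fun u hu => (hder u (interior_mono hsub hu)).differentiableAt.differentiableWithinAt)
    (C := c * ((y - x) / 4 ^ Z.card) ^ Z.card)
    (fun u hu => by
      rw [(hder u (interior_mono hsub hu)).deriv]
      have hu' := interior_subset hu
      refine le_trans (mul_le_mul_of_nonneg_left ?_ hc) (hg u (hsub hu'))
      calc ((y - x) / 4 ^ Z.card) ^ Z.card = ∏ _z ∈ Z, ((y - x) / 4 ^ Z.card) := by rw [Finset.prod_const]
        _ ≤ _ := Finset.prod_le_prod (fun _ _ => hL) fun z hz => h5 z hz u hu')
    x' ⟨le_rfl, h2⟩ y' ⟨h2, le_rfl⟩ h2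
  have hx : G x ≤ G x' := hmono ⟨le_rfl, hxy⟩ ⟨h1, h2.trans h3⟩ h1
  have hy : G y' ≤ G y := hmono ⟨h1.trans h2, h3⟩ ⟨hxy, le_rfl⟩ h3
  calc c * ((y - x) / 4 ^ Z.card) ^ (Z.card + 1)
      = c * ((y - x) / 4 ^ Z.card) ^ Z.card * (y' - x') := by rw [h4]; ring
    _ ≤ G y' - G x' := key
    _ ≤ G y - G x := by linarith

/-! ### Directions adapted to a nondegenerate curve -/

theorem IsNondegenerateCurve.eq_zero_of_inner_eq_zero {n : ℕ} {γ : ℝ → EuclideanSpace ℝ (Fin n)}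
    (hγ : IsNondegenerateCurve γ) {t : ℝ} (ht : t ∈ Icc (0 : ℝ) 1) {v : EuclideanSpace ℝ (Fin n)}
    (hv : ∀ k : Fin n, inner ℝ v (iteratedDerivWithin ((k : ℕ) + 1) γ (Icc 0 1) t) = 0) :
    v = 0 := by
  have h := Matrix.eq_zero_of_vecMul_eq_zero (hγ.det_ne_zero t ht) (v := v.ofLp) (by
    ext k
    have := hv k
    rw [PiLp.inner_apply] at this
    simpa [Matrix.vecMul, dotProduct, mul_comm] using this)
  ext i
  exact congrFun h i

theorem IsNondegenerateCurve.continuousOn_iteratedDerivWithin {n : ℕ}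
    {γ : ℝ → EuclideanSpace ℝ (Fin n)} (hγ : IsNondegenerateCurve γ) (k : Fin n) :
    ContinuousOn (fun t => iteratedDerivWithin ((k : ℕ) + 1) γ (Icc 0 1) t) (Icc 0 1) :=
  hγ.contDiffOn.continuousOn_iteratedDerivWithin (by exact_mod_cast k.2) (uniqueDiffOn_Icc_zero_one)

/-- At a common point `ξ k = t` this is compactness of `[0,1]` times the unit sphere; uniform
continuity of the derivatives then allows a different nearby point for each order. That freedom is
needed because Rolle gives no control over where the zeros lie. -/
theorem IsNondegenerateCurve.exists_le_sum_inner {n : ℕ} (hn : 1 ≤ n)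
    {γ : ℝ → EuclideanSpace ℝ (Fin n)} (hγ : IsNondegenerateCurve γ) :
    ∃ c > 0, ∃ δ > 0, ∀ ξ : Fin n → ℝ, (∀ k, ξ k ∈ Icc (0 : ℝ) 1) → (∀ k l, |ξ k - ξ l| ≤ δ) →
      ∀ v : EuclideanSpace ℝ (Fin n), c * ‖v‖ ≤
        ∑ k : Fin n, |inner ℝ v (iteratedDerivWithin ((k : ℕ) + 1) γ (Icc 0 1) (ξ k))| := by
  set D : Fin n → ℝ → EuclideanSpace ℝ (Fin n) :=
    fun k t => iteratedDerivWithin ((k : ℕ) + 1) γ (Icc 0 1) t with hD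
  have hDc : ∀ k, ContinuousOn (D k) (Icc 0 1) := hγ.continuousOn_iteratedDerivWithin
  set F : ℝ × EuclideanSpace ℝ (Fin n) → ℝ := fun p => ∑ k, |inner ℝ p.2 (D k p.1)| with hF
  have hFc : ContinuousOn F (Icc 0 1 ×ˢ Metric.sphere 0 1) := by
    refine continuousOn_finsetSum _ fun k _ => ContinuousOn.abs ?_
    refine ContinuousOn.inner continuousOn_snd ?_
    exact (hDc k).comp continuousOn_fst fun p hp => hp.1
  have : Nontrivial (EuclideanSpace ℝ (Fin n)) := by
    have : Nonempty (Fin n) := ⟨⟨0, hn⟩⟩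
    infer_instance
  have hne : (Icc (0 : ℝ) 1 ×ˢ Metric.sphere (0 : EuclideanSpace ℝ (Fin n)) 1).Nonempty :=
    (nonempty_Icc.2 zero_le_one).prod (NormedSpace.sphere_nonempty.2 zero_le_one)
  obtain ⟨p, hp, hmin⟩ := (isCompact_Icc.prod (isCompact_sphere _ _)).exists_isMinOn hne hFc
  have hF0 : ∀ p, 0 ≤ F p := fun p => Finset.sum_nonneg fun _ _ => abs_nonneg _
  have hpos : 0 < F p := by
    refine lt_of_le_of_ne (hF0 p) fun h => ?_
    have h' := (Finset.sum_eq_zero_iff_of_nonneg fun _ _ => abs_nonneg _).1 h.symm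
    have hz := hγ.eq_zero_of_inner_eq_zero hp.1 (v := p.2)
      fun k => abs_eq_zero.1 (h' k (Finset.mem_univ _))
    have := hp.2
    rw [hz] at this
    simp at this
  have hn0 : (0 : ℝ) < n := by exact_mod_cast hn
  have huc : UniformContinuousOn (fun t => fun k => D k t) (Icc 0 1) :=
    isCompact_Icc.uniformContinuousOn_of_continuous (continuousOn_pi.2 hDc)
  -- The `n` errors of this size add up to half of the minimum `F p`.
  obtain ⟨δ, hδ, hδ'⟩ := Metric.uniformContinuousOn_iff.1 huc (F p / (2 * n)) (by positivity)
  refine ⟨F p / 2, by positivity, δ / 2, by positivity, fun ξ hξ hξξ v => ?_⟩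
  have key : ∀ v : EuclideanSpace ℝ (Fin n), ‖v‖ = 1 →
      F p / 2 ≤ ∑ k : Fin n, |inner ℝ v (D k (ξ k))| := by
    intro v hv
    set t := ξ ⟨0, hn⟩
    have h1 : F p ≤ F (t, v) := hmin ⟨hξ _, by simpa using hv⟩
    have h2 : ∀ k, |inner ℝ v (D k t)| ≤ |inner ℝ v (D k (ξ k))| + F p / (2 * n) := by
      intro k
      have hd : ‖D k t - D k (ξ k)‖ ≤ F p / (2 * n) := by
        have := hδ' t (hξ _) (ξ k) (hξ _) (by
          rw [Real.dist_eq]; linarith [hξξ ⟨0, hn⟩ k])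
        rw [← dist_eq_norm]
        exact ((dist_pi_lt_iff (by positivity)).1 this k).le
      have h3 : inner ℝ v (D k t) = inner ℝ v (D k (ξ k)) + inner ℝ v (D k t - D k (ξ k)) := by
        rw [inner_sub_right]; ring
      rw [h3]
      refine (abs_add_le _ _).trans (add_le_add_right ?_ _)
      refine (abs_real_inner_le_norm _ _).trans ?_
      rwa [hv, one_mul]
    have h4 : F (t, v) ≤ ∑ k : Fin n, (|inner ℝ v (D k (ξ k))| + F p / (2 * n)) :=
      Finset.sum_le_sum fun k _ => h2 k
    rw [Finset.sum_add_distrib, Finset.sum_const, Finset.card_univ, Fintype.card_fin,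
      nsmul_eq_mul] at h4
    have h5 : (n : ℝ) * (F p / (2 * n)) = F p / 2 := by field_simp
    linarith
  by_cases hv : v = 0
  · subst hv; simp
  have hv' : 0 < ‖v‖ := norm_pos_iff.2 hv
  have := key (‖v‖⁻¹ • v) (by rw [norm_smul, norm_inv, norm_norm, inv_mul_cancel₀ hv'.ne'])
  simp only [real_inner_smul_left, abs_mul, abs_inv, abs_norm, ← Finset.mul_sum] at this
  rw [← div_eq_inv_mul, le_div_iff₀ hv'] at this
  exact this

theorem IsNondegenerateCurve.hasDerivWithinAt {n : ℕ} {γ : ℝ → EuclideanSpace ℝ (Fin n)}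
    (hγ : IsNondegenerateCurve γ) {k : ℕ} (hk : k < n) {u : ℝ} (hu : u ∈ Icc (0 : ℝ) 1) :
    HasDerivWithinAt (iteratedDerivWithin k γ (Icc 0 1))
      (iteratedDerivWithin (k + 1) γ (Icc 0 1) u) (Icc 0 1) u := by
  rw [iteratedDerivWithin_succ]
  exact (hγ.contDiffOn.differentiableOn_iteratedDerivWithin (by exact_mod_cast hk)
    uniqueDiffOn_Icc_zero_one u hu).hasDerivWithinAt

/-- Some direction `v` in which the derivative of the curve vanishes exactly at prescribed points of
a short interval. -/
theorem IsNondegenerateCurve.exists_inner_deriv_eq_mul_prod {n : ℕ} (hn : 1 ≤ n)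
    {γ : ℝ → EuclideanSpace ℝ (Fin n)} (hγ : IsNondegenerateCurve γ) :
    ∃ c > 0, ∃ δ > 0, ∀ a b : ℝ, 0 ≤ a → a ≤ b → b ≤ 1 → b - a ≤ δ → ∀ Z : Finset ℝ,
      ↑Z ⊆ Icc a b → Z.card < n → ∃ v : EuclideanSpace ℝ (Fin n), ‖v‖ = 1 ∧
        ∀ u ∈ Icc a b, ∃ q, c ≤ q ∧
          inner ℝ v (iteratedDerivWithin 1 γ (Icc 0 1) u) = q * ∏ z ∈ Z, (u - z) := by
  classical
  obtain ⟨c, hc, δ, hδ, H⟩ := hγ.exists_le_sum_inner hn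
  -- The interpolation remainder divides by `Z.card!`, which is at most `n!`.
  refine ⟨c / n.factorial, by positivity, δ, hδ, fun a b ha hab hb hba Z hZ hZn => ?_⟩
  set D : ℕ → ℝ → EuclideanSpace ℝ (Fin n) :=
    fun k t => iteratedDerivWithin (k + 1) γ (Icc 0 1) t with hD
  have hsub : Icc a b ⊆ Icc 0 1 := Icc_subset_Icc ha hb
  -- the linear conditions: vanishing at `Z`, and of the higher derivatives at `a`
  let cond : Fin (n - 1) → EuclideanSpace ℝ (Fin n) := fun i =>
    if h : (i : ℕ) < Z.card then D 0 (Z.orderEmbOfFin rfl ⟨i, h⟩) else D (i + 1) a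
  let Λ : EuclideanSpace ℝ (Fin n) →ₗ[ℝ] (Fin (n - 1) → ℝ) :=
    LinearMap.pi fun i => (innerₗ (EuclideanSpace ℝ (Fin n))) (cond i)
  -- There are `n - 1` linear conditions in dimension `n`, so a nonzero `v` remains.
  have hker : LinearMap.ker Λ ≠ ⊥ := LinearMap.ker_ne_bot_of_finrank_lt (by simp; omega)
  obtain ⟨v, hv, hv0⟩ := (Submodule.ne_bot_iff _).1 hker
  have hcond : ∀ i, inner ℝ v (cond i) = 0 := by
    intro i
    have := congrFun (LinearMap.mem_ker.1 hv) i
    simpa [Λ, real_inner_comm] using this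
  have hcZ : ∀ z ∈ Z, inner ℝ v (D 0 z) = 0 := by
    intro z hz
    have hz' : z ∈ Set.range (Z.orderEmbOfFin rfl) := by
      rw [Finset.range_orderEmbOfFin]; exact hz
    obtain ⟨i, rfl⟩ := hz'
    have := hcond ⟨i, by omega⟩
    simpa [cond] using this
  have hca : ∀ k, Z.card < k → k < n → inner ℝ v (D k a) = 0 := by
    intro k hk hkn
    have := hcond ⟨k - 1, by omega⟩
    have h1 : ¬ (k - 1 < Z.card) := by omega
    simp only [cond, h1, dite_false] at this
    rwa [show k - 1 + 1 = k by omega] at this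
  -- Rolle
  have hder : ∀ (w : EuclideanSpace ℝ (Fin n)), ∀ i < Z.card, ∀ u ∈ Icc a b,
      HasDerivWithinAt (fun t => inner ℝ w (D i t)) (inner ℝ w (D (i + 1) u)) (Icc a b) u := by
    intro w i hi u hu
    have := ((hγ.hasDerivWithinAt (k := i + 1) (by omega) (hsub hu)).mono hsub)
    exact ((innerSL ℝ w).hasFDerivAt.comp_hasDerivWithinAt u this)
  have hroll : ∀ k < Z.card, ∃ ξ ∈ Icc a b, inner ℝ v (D k ξ) = 0 := fun k hk =>
    exists_iterated_deriv_eq_zero (g := fun k t => inner ℝ v (D k t)) hZ hcZ k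
      (fun i hi => hder v i (hi.trans hk)) hk
  choose! ζ hζ hζ0 using hroll
  have hlow : ∀ u ∈ Icc a b, c * ‖v‖ ≤ |inner ℝ v (D Z.card u)| := by
    intro u hu
    -- Evaluation points that kill every summand except the one of index `Z.card`: Rolle zeros below
    -- it, the imposed zeros at `a` above it.
    let ξ : Fin n → ℝ := fun k =>
      if (k : ℕ) < Z.card then ζ k else if (k : ℕ) = Z.card then u else a
    have hξ : ∀ k, ξ k ∈ Icc a b := by
      intro k
      simp only [ξ]
      split_ifs with h1 h2
      exacts [hζ _ h1, hu, ⟨le_rfl, hab⟩]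
    have := H ξ (fun k => hsub (hξ k)) (fun k l => by
      rw [abs_le]
      constructor <;> linarith [(hξ k).1, (hξ k).2, (hξ l).1, (hξ l).2]) v
    rw [Finset.sum_eq_single (⟨Z.card, hZn⟩ : Fin n)] at this
    · simpa [ξ] using this
    · intro k _ hk
      have hk' : (k : ℕ) ≠ Z.card := fun h => hk (Fin.ext h)
      rw [abs_eq_zero]
      rcases lt_or_gt_of_ne hk' with h | h
      · simpa [ξ, h] using hζ0 k h
      · simpa [ξ, hk', not_lt.2 h.le] using hca k h k.2
    · simp
  have hvpos : 0 < ‖v‖ := norm_pos_iff.2 hv0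
  -- the sign is constant
  have hcont : ContinuousOn (fun u => inner ℝ v (D Z.card u)) (Icc a b) :=
    ContinuousOn.inner continuousOn_const
      ((hγ.continuousOn_iteratedDerivWithin ⟨Z.card, hZn⟩).mono hsub)
  obtain ⟨e, he, hsign⟩ : ∃ e : ℝ, |e| = 1 ∧
      ∀ u ∈ Icc a b, c * ‖v‖ ≤ e * inner ℝ v (D Z.card u) := by
    have hcv : 0 < c * ‖v‖ := by positivity
    rcases le_or_gt 0 (inner ℝ v (D Z.card a)) with h | h
    · refine ⟨1, by simp, fun u hu => ?_⟩
      rw [one_mul]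
      rcases le_abs.1 (hlow u hu) with h' | h'
      · exact h'
      exfalso
      obtain ⟨w, hw, hw0⟩ := isPreconnected_Icc.intermediate_value hu
        (show a ∈ Icc a b from ⟨le_rfl, hab⟩) hcont
        (show (0 : ℝ) ∈ Icc _ _ from ⟨by linarith, h⟩)
      have := hlow w hw
      simp only at hw0
      rw [hw0, abs_zero] at this
      linarith
    · refine ⟨-1, by simp, fun u hu => ?_⟩
      rcases le_abs.1 (hlow u hu) with h' | h'
      swap
      · linarith
      exfalso
      obtain ⟨w, hw, hw0⟩ := isPreconnected_Icc.intermediate_value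
        (show a ∈ Icc a b from ⟨le_rfl, hab⟩) hu hcont
        (show (0 : ℝ) ∈ Icc _ _ from ⟨h.le, by linarith⟩)
      have := hlow w hw
      simp only at hw0
      rw [hw0, abs_zero] at this
      linarith
  -- The sign `e` makes the quotient `q` in the interpolation formula positive.
  refine ⟨(e / ‖v‖) • v, ?_, fun u hu => ?_⟩
  · rw [norm_smul, Real.norm_eq_abs, abs_div, he, abs_norm, one_div, inv_mul_cancel₀ hvpos.ne']
  obtain ⟨ξ, hξ, hξe⟩ := exists_factorial_mul_eq_iterated_deriv_mul_prod
    (g := fun k t => inner ℝ v (D k t)) hZ hcZ (hder v) hu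
  have hfac : (0 : ℝ) < Z.card.factorial := by positivity
  refine ⟨e / ‖v‖ * inner ℝ v (D Z.card ξ) / Z.card.factorial, ?_, ?_⟩
  · have h1 : c ≤ e / ‖v‖ * inner ℝ v (D Z.card ξ) := by
      rw [div_mul_eq_mul_div, le_div_iff₀ hvpos]; exact hsign ξ hξ
    have h2 : (Z.card.factorial : ℝ) ≤ n.factorial := by
      exact_mod_cast Nat.factorial_le hZn.le
    exact div_le_div₀ (hc.le.trans h1) h1 hfac h2
  · rw [real_inner_smul_left]
    have : inner ℝ v (D 0 u) = inner ℝ v (D Z.card ξ) * (∏ z ∈ Z, (u - z)) / Z.card.factorial := by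
      rw [eq_div_iff hfac.ne', ← hξe]; ring
    rw [show iteratedDerivWithin 1 γ (Icc 0 1) u = D 0 u from rfl, this]
    ring

/-! ### Matching points whose sums along the curve nearly agree -/

theorem sub_ge_of_sign_change {n : ℕ} {γ : ℝ → EuclideanSpace ℝ (Fin n)}
    (hn : 1 ≤ n) (hγ : IsNondegenerateCurve γ) {a b c : ℝ} (hc : 0 < c) (ha : 0 ≤ a) (hb : b ≤ 1)
    {Z : Finset ℝ} {v : EuclideanSpace ℝ (Fin n)} {x y e : ℝ} (he : |e| = 1)
    (hx : x ∈ Icc a b) (hy : y ∈ Icc a b) (hxy : x ≤ y)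
    (hv : ∀ u ∈ Icc a b, ∃ q, c ≤ q ∧
      inner ℝ v (iteratedDerivWithin 1 γ (Icc 0 1) u) = q * ∏ z ∈ Z, (u - z))
    (hs : ∀ u ∈ Icc x y, 0 ≤ e * ∏ z ∈ Z, (u - z)) :
    c * ((y - x) / 4 ^ Z.card) ^ (Z.card + 1) ≤ e * inner ℝ v (γ y - γ x) := by
  have hsub : Icc x y ⊆ Icc a b := Icc_subset_Icc hx.1 hy.2
  have hsub' : Icc x y ⊆ Icc 0 1 := hsub.trans (Icc_subset_Icc ha hb)
  have := sub_ge_of_deriv_ge_prod (G := fun u => e * inner ℝ v (γ u))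
    (g := fun u => e * inner ℝ v (iteratedDerivWithin 1 γ (Icc 0 1) u)) hxy hc.le
    (fun u hu => by
      have h1 := (hγ.hasDerivWithinAt (k := 0) hn (hsub' hu)).mono hsub'
      rw [iteratedDerivWithin_zero] at h1
      exact ((innerSL ℝ v).hasFDerivAt.comp_hasDerivWithinAt u h1).const_mul e) Z
    (fun u hu => by
      obtain ⟨q, hq, h⟩ := hv u (hsub hu)
      have h2 : ∏ z ∈ Z, |u - z| = e * ∏ z ∈ Z, (u - z) := by
        rw [← Finset.abs_prod, ← abs_of_nonneg (hs u hu), abs_mul, he, one_mul]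
      rw [h, h2]
      nlinarith [mul_le_mul_of_nonneg_right hq (hs u hu)])
  rw [inner_sub_right, mul_sub]
  exact this

/-- Choose `v` so that `v · γ'` vanishes exactly at the sign change points. All `e * v · (γ(t_j) -
γ(s_j))` are then nonnegative, so each of them is at most the norm of the full difference. -/
theorem IsNondegenerateCurve.exists_sorted_matching {n : ℕ} (hn : 1 ≤ n)
    {γ : ℝ → EuclideanSpace ℝ (Fin n)} (hγ : IsNondegenerateCurve γ) :
    ∃ C > 0, ∃ δ > 0, ∀ m ≤ n, ∀ a b : ℝ, 0 ≤ a → b ≤ 1 → b - a ≤ δ → ∀ t s : Fin m → ℝ,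
      Monotone t → Monotone s → (∀ i, t i ∈ Icc a b) → (∀ i, s i ∈ Icc a b) →
      ∀ i, |t i - s i| ^ n ≤ C * ‖∑ j, γ (t j) - ∑ j, γ (s j)‖ := by
  obtain ⟨c, hc, δ, hδ, H⟩ := hγ.exists_inner_deriv_eq_mul_prod hn
  refine ⟨4 ^ (n * (n + 1)) / c, by positivity, δ, hδ,
    fun m hmn a b ha hb hab t s ht hs hta hsa i => ?_⟩
  have hm : 1 ≤ m := by have := i.2; omega
  have hab' : a ≤ b := (hta i).1.trans (hta i).2
  -- The value `0` beyond `m` is never read.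
  let t' : ℕ → ℝ := fun k => if h : k < m then t ⟨k, h⟩ else 0
  let s' : ℕ → ℝ := fun k => if h : k < m then s ⟨k, h⟩ else 0
  have ht' : ∀ k (h : k < m), t' k = t ⟨k, h⟩ := fun k h => by simp [t', h]
  have hs' : ∀ k (h : k < m), s' k = s ⟨k, h⟩ := fun k h => by simp [s', h]
  obtain ⟨Z, e, hZ, hZm, he, hsign⟩ := exists_sign_change_points (t := t') (s := s') hm
    (fun p q hpq hq => by rw [ht' p (by omega), ht' q hq]; exact ht hpq)
    (fun p q hpq hq => by rw [hs' p (by omega), hs' q hq]; exact hs hpq)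
    (a := a) (b := b) (fun p hp => by rw [ht' p hp]; exact hta _)
    (fun p hp => by rw [hs' p hp]; exact hsa _)
  have he1 : |e| = 1 := by rcases he with rfl | rfl <;> simp
  obtain ⟨v, hv1, hv⟩ := H a b ha hab' hb hab Z hZ (by omega)
  have hterm : ∀ j, c * (|t j - s j| / 4 ^ Z.card) ^ (Z.card + 1) ≤
      e * inner ℝ v (γ (t j) - γ (s j)) := by
    intro j
    have hsj : ∀ u ∈ uIcc (s j) (t j), 0 ≤ e * (t j - s j) * ∏ z ∈ Z, (u - z) := by
      have := hsign j j.2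
      rwa [ht' j j.2, hs' j j.2] at this
    rcases lt_trichotomy (s j) (t j) with h | h | h
    · rw [abs_of_pos (sub_pos.2 h)]
      refine sub_ge_of_sign_change hn hγ hc ha hb he1 (hsa j) (hta j) h.le hv fun u hu => ?_
      rw [← uIcc_of_le h.le] at hu
      have := hsj u hu
      rw [mul_right_comm] at this
      exact nonneg_of_mul_nonneg_left this (sub_pos.2 h)
    · rw [h]; simp
    -- The same estimate with the endpoints exchanged and `-e` in place of `e`.
    · rw [abs_sub_comm, abs_of_pos (sub_pos.2 h)]
      have := sub_ge_of_sign_change (e := -e) hn hγ hc ha hb (by rwa [abs_neg]) (hta j) (hsa j)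
        h.le hv fun u hu => by
          rw [← uIcc_of_ge h.le] at hu
          have := hsj u hu
          have h3 : 0 ≤ -e * (∏ z ∈ Z, (u - z)) * (s j - t j) := by linarith
          exact nonneg_of_mul_nonneg_left h3 (sub_pos.2 h)
      rw [inner_sub_right] at this ⊢
      linarith
  have hnonneg : ∀ j, 0 ≤ c * (|t j - s j| / 4 ^ Z.card) ^ (Z.card + 1) := fun j => by positivity
  have hsum : c * (|t i - s i| / 4 ^ Z.card) ^ (Z.card + 1) ≤
      ‖∑ j, γ (t j) - ∑ j, γ (s j)‖ := by
    calc c * (|t i - s i| / 4 ^ Z.card) ^ (Z.card + 1)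
        ≤ ∑ j, c * (|t j - s j| / 4 ^ Z.card) ^ (Z.card + 1) :=
          Finset.single_le_sum (fun j _ => hnonneg j) (Finset.mem_univ i)
      _ ≤ ∑ j, e * inner ℝ v (γ (t j) - γ (s j)) := Finset.sum_le_sum fun j _ => hterm j
      _ = e * inner ℝ v (∑ j, γ (t j) - ∑ j, γ (s j)) := by
          rw [← Finset.mul_sum, ← inner_sum, Finset.sum_sub_distrib]
      _ ≤ |e * inner ℝ v (∑ j, γ (t j) - ∑ j, γ (s j))| := le_abs_self _
      _ ≤ _ := by
          rw [abs_mul, he1, one_mul]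
          simpa [hv1] using abs_real_inner_le_norm v (∑ j, γ (t j) - ∑ j, γ (s j))
  -- This permits raising the exponent `Z.card + 1` to `n`.
  have hle1 : |t i - s i| ≤ 1 := by
    rw [abs_le]
    constructor <;> linarith [(hta i).1, (hta i).2, (hsa i).1, (hsa i).2]
  rw [div_mul_eq_mul_div, le_div_iff₀ hc]
  calc |t i - s i| ^ n * c ≤ |t i - s i| ^ (Z.card + 1) * c :=
        mul_le_mul_of_nonneg_right (pow_le_pow_of_le_one (abs_nonneg _) hle1 (by omega)) hc.le
    _ = 4 ^ (Z.card * (Z.card + 1)) * (c * (|t i - s i| / 4 ^ Z.card) ^ (Z.card + 1)) := by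
        rw [div_pow, ← pow_mul]
        field_simp
    _ ≤ 4 ^ (n * (n + 1)) * ‖∑ j, γ (t j) - ∑ j, γ (s j)‖ := by
        refine mul_le_mul ?_ hsum (hnonneg i) (by positivity)
        exact pow_le_pow_right₀ (by norm_num) (Nat.mul_le_mul (by omega) (by omega))

/-- Two families of points in a short interval with nearly the same sum along the curve are nearly
permutations of each other. -/
theorem IsNondegenerateCurve.exists_matching {n : ℕ} (hn : 1 ≤ n)
    {γ : ℝ → EuclideanSpace ℝ (Fin n)} (hγ : IsNondegenerateCurve γ) :
    ∃ C > 0, ∃ δ > 0, ∀ m ≤ n, ∀ a b : ℝ, 0 ≤ a → b ≤ 1 → b - a ≤ δ → ∀ t s : Fin m → ℝ,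
      (∀ i, t i ∈ Icc a b) → (∀ i, s i ∈ Icc a b) → ∃ σ : Equiv.Perm (Fin m),
      ∀ i, |t i - s (σ i)| ^ n ≤ C * ‖∑ j, γ (t j) - ∑ j, γ (s j)‖ := by
  obtain ⟨C, hC, δ, hδ, H⟩ := hγ.exists_sorted_matching hn
  refine ⟨C, hC, δ, hδ, fun m hmn a b ha hb hab t s ht hs => ?_⟩
  -- Points of equal rank are paired.
  refine ⟨(Tuple.sort t).symm.trans (Tuple.sort s), fun i => ?_⟩
  have := H m hmn a b ha hb hab (t ∘ Tuple.sort t) (s ∘ Tuple.sort s) (Tuple.monotone_sort t)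
    (Tuple.monotone_sort s) (fun i => ht _) (fun i => hs _) ((Tuple.sort t).symm i)
  simp only [Function.comp_apply, Equiv.apply_symm_apply] at this
  rw [Equiv.sum_comp (Tuple.sort t) (fun j => γ (t j)),
    Equiv.sum_comp (Tuple.sort s) (fun j => γ (s j))] at this
  exact this

/-! ### A weight with compact frequency support -/

section

open scoped SchwartzMap FourierTransform

theorem SchwartzMap.integrable_one_add_norm_pow_mul {V : Type*} [NormedAddCommGroup V]
    [NormedSpace ℝ V] [MeasurableSpace V] [BorelSpace V] [SecondCountableTopology V]
    (μ : Measure V) [μ.HasTemperateGrowth] (h : 𝓢(V, ℂ)) (k : ℕ) :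
    Integrable (fun x => (1 + ‖x‖) ^ k * ‖h x‖) μ := by
  have h1 := ((h.integrable_pow_mul μ 0).add (h.integrable_pow_mul μ k)).const_mul (2 ^ (k - 1))
  refine h1.mono' (by have := h.continuous; fun_prop) (ae_of_all _ fun x => ?_)
  rw [Real.norm_of_nonneg (by positivity)]
  have := mul_le_mul_of_nonneg_right (add_pow_le zero_le_one (norm_nonneg x) k) (norm_nonneg (h x))
  simp only [Pi.add_apply, pow_zero, one_pow, one_mul] at this ⊢
  linarith

/-- A nonnegative, rapidly decaying function whose Fourier transform has compact support. -/
theorem exists_band_limited_weight (n : ℕ) (E : ℝ) :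
    ∃ φ : EuclideanSpace ℝ (Fin n) → ℝ, Continuous φ ∧ (∀ x, 0 ≤ φ x) ∧ (∃ x, φ x ≠ 0) ∧
      Integrable (fun x => (1 + ‖x‖) ^ E * φ x) ∧ ∃ r > 0, ∀ ξ, r ≤ ‖ξ‖ →
        ∫ x, (φ x : ℂ) * Complex.exp (2 * Real.pi * Complex.I * (inner ℝ x ξ : ℝ)) = 0 := by
  let b : ContDiffBump (0 : EuclideanSpace ℝ (Fin n)) := ⟨1, 2, one_pos, one_lt_two⟩
  have hbc : HasCompactSupport fun x => (b x : ℂ) :=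
    b.hasCompactSupport.comp_left (g := fun r : ℝ => (r : ℂ)) Complex.ofReal_zero
  have hbs : ContDiff ℝ ((⊤ : ℕ∞) : WithTop ℕ∞) fun x => (b x : ℂ) :=
    Complex.ofRealCLM.contDiff.comp b.contDiff
  set ψ : 𝓢(EuclideanSpace ℝ (Fin n), ℂ) := hbc.toSchwartzMap hbs with hψ
  have hψb : ∀ x, ψ x = (b x : ℂ) := fun x => rfl
  have hψ0 : ∀ x, 2 ≤ ‖x‖ → ψ x = 0 := by
    intro x hx
    rw [hψb, b.zero_of_le_dist (by simpa using hx)]; simp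
  set Ψ : 𝓢(EuclideanSpace ℝ (Fin n), ℂ) := 𝓕 ψ with hΨ
  have hcont : Continuous Ψ := Ψ.continuous
  -- The Fourier transform of `|𝓕 ψ|^2` is an autocorrelation of `ψ`. As `ψ` vanishes outside the
  -- ball of radius `2`, the radius `4` suffices.
  refine ⟨fun x => ‖Ψ x‖ ^ 2, by fun_prop, fun x => by positivity, ?_, ?_, 4, by norm_num, ?_⟩
  · by_contra! h
    have h0 : Ψ = 0 := by
      ext x
      simpa using h x
    have h1 : ψ = 0 := by
      have h2 := FourierTransform.fourierInv_fourier_eq (F := 𝓢(EuclideanSpace ℝ (Fin n), ℂ)) ψ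
      rw [← h2, ← hΨ, h0]
      exact FourierTransform.fourierInv_zero
    have h2 : ψ 0 = 1 := by
      rw [hψb, b.one_of_mem_closedBall (by simp [b])]; simp
    rw [h1] at h2
    simp at h2
  · obtain ⟨k, hk⟩ := exists_nat_ge E
    obtain ⟨M, hM⟩ : ∃ M, ∀ x, ‖Ψ x‖ ≤ M := ⟨_, fun x => SchwartzMap.norm_fourier_apply_le_toLp_one ψ x⟩
    refine ((Ψ.integrable_one_add_norm_pow_mul volume k).mul_const M).mono' ?_
      (ae_of_all _ fun x => ?_)
    · refine Continuous.aestronglyMeasurable (Continuous.mul ?_ (by fun_prop))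
      exact Continuous.rpow_const (by fun_prop) fun x => Or.inl (by positivity)
    · rw [Real.norm_of_nonneg (by positivity)]
      have h1 : (1 + ‖x‖) ^ E ≤ (1 + ‖x‖) ^ k := by
        rw [← Real.rpow_natCast]
        exact Real.rpow_le_rpow_of_exponent_le (by linarith [norm_nonneg x]) hk
      simp only [sq]
      rw [mul_assoc]
      exact mul_le_mul h1 (mul_le_mul_of_nonneg_left (hM x) (norm_nonneg _)) (by positivity)
        (by positivity)
  · intro ξ hξ
    -- Translating `ψ` by `ξ` multiplies `𝓕 ψ` by the required exponential, so by Plancherel the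
    -- integral is the inner product of `ψ` with its translate, and these have no common support.
    have hgc : HasCompactSupport fun x => ψ (x + ξ) :=
      (show HasCompactSupport ψ from hbc).comp_homeomorph (Homeomorph.addRight ξ)
    have hgs : ContDiff ℝ ((⊤ : ℕ∞) : WithTop ℕ∞) fun x => ψ (x + ξ) :=
      (show ContDiff ℝ _ ψ from hbs).comp (contDiff_id.add contDiff_const)
    set g : 𝓢(EuclideanSpace ℝ (Fin n), ℂ) := hgc.toSchwartzMap hgs with hg
    set Γ : 𝓢(EuclideanSpace ℝ (Fin n), ℂ) := 𝓕 g with hΓ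
    have hgF : ∀ x, Γ x = Complex.exp (2 * Real.pi * Complex.I * (inner ℝ x ξ : ℝ)) * Ψ x := by
      intro x
      have h1 := congrFun (VectorFourier.fourierIntegral_comp_add_right Real.fourierChar volume
        (innerₗ (EuclideanSpace ℝ (Fin n))) (ψ : EuclideanSpace ℝ (Fin n) → ℂ) ξ) x
      change 𝓕 (ψ ∘ fun v => v + ξ) x = _ at h1
      change 𝓕 (ψ ∘ fun v => v + ξ) x = _
      rw [h1, Circle.smul_def, Real.fourierChar_apply, smul_eq_mul, innerₗ_apply_apply,
        real_inner_comm]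
      congr 2
      push_cast
      ring
    have h2 := SchwartzMap.integral_inner_fourier_fourier ψ g
    have h3 : ∫ x, inner ℂ (ψ x) (g x) = 0 := by
      refine integral_eq_zero_of_ae (ae_of_all _ fun x => ?_)
      have hgx : g x = ψ (x + ξ) := rfl
      by_cases hx : 2 ≤ ‖x‖
      · simp [hψ0 x hx]
      · have : 2 ≤ ‖x + ξ‖ := by
          have := norm_sub_le (x + ξ) x
          rw [add_sub_cancel_left] at this
          linarith
        simp [hgx, hψ0 _ this]
    rw [h3, ← hΨ, ← hΓ] at h2
    rw [← h2]
    refine integral_congr_ae (ae_of_all _ fun x => ?_)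
    simp only [hgF, RCLike.inner_apply]
    rw [Complex.ofReal_pow, ← Complex.mul_conj']
    ring

end

/-! ### The extension operator and orthogonality of products -/

theorem extensionOp_congr {n : ℕ} {γ γ' : ℝ → EuclideanSpace ℝ (Fin n)} {I : Set ℝ}
    (hI : MeasurableSet I) (h : EqOn γ γ' I) (f : ℝ → ℂ) (x : EuclideanSpace ℝ (Fin n)) :
    extensionOp γ I f x = extensionOp γ' I f x :=
  setIntegral_congr_fun hI fun t ht => by simp only [h ht]

theorem norm_exp_two_pi_I_mul (r : ℝ) :
    ‖Complex.exp (2 * Real.pi * Complex.I * (r : ℝ))‖ = 1 := by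
  have : (2 * Real.pi * Complex.I * (r : ℝ) : ℂ) = ((2 * Real.pi * r : ℝ) : ℂ) * Complex.I := by
    push_cast; ring
  rw [this, Complex.norm_exp_ofReal_mul_I]

theorem integrableOn_exp_mul {n : ℕ} {γ : ℝ → EuclideanSpace ℝ (Fin n)} (hγ : Continuous γ)
    {I : Set ℝ} {f : ℝ → ℂ} (hf : IntegrableOn f I) (x : EuclideanSpace ℝ (Fin n)) :
    IntegrableOn (fun t => Complex.exp (2 * Real.pi * Complex.I * (inner ℝ x (γ t) : ℝ)) * f t)
      I := by
  refine Integrable.bdd_mul (c := 1) hf ?_ (ae_of_all _ fun t => (norm_exp_two_pi_I_mul _).le)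
  exact Continuous.aestronglyMeasurable (by fun_prop)

theorem norm_extensionOp_le {n : ℕ} (γ : ℝ → EuclideanSpace ℝ (Fin n)) (I : Set ℝ) (f : ℝ → ℂ)
    (x : EuclideanSpace ℝ (Fin n)) : ‖extensionOp γ I f x‖ ≤ ∫ t in I, ‖f t‖ := by
  refine (norm_integral_le_integral_norm _).trans_eq ?_
  simp only [norm_mul, norm_exp_two_pi_I_mul, one_mul]

theorem continuous_extensionOp {n : ℕ} {γ : ℝ → EuclideanSpace ℝ (Fin n)} (hγ : Continuous γ)
    {I : Set ℝ} {f : ℝ → ℂ} (hf : IntegrableOn f I) : Continuous (extensionOp γ I f) := by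
  refine continuous_of_dominated (bound := fun t => ‖f t‖)
    (fun x => (integrableOn_exp_mul hγ hf x).aestronglyMeasurable)
    (fun x => ae_of_all _ fun t => ?_) hf.norm (ae_of_all _ fun t => by fun_prop)
  rw [norm_mul, norm_exp_two_pi_I_mul, one_mul]

theorem prod_extensionOp_eq_integral {n m : ℕ} {γ : ℝ → EuclideanSpace ℝ (Fin n)}
    (A : Fin m → Set ℝ) (f : ℝ → ℂ) (x : EuclideanSpace ℝ (Fin n)) :
    ∏ i, extensionOp γ (A i) f x = ∫ t, Complex.exp (2 * Real.pi * Complex.I *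
      (inner ℝ x (∑ i, γ (t i)) : ℝ)) * ∏ i, f (t i)
        ∂(Measure.pi fun i => volume.restrict (A i)) := by
  simp only [extensionOp]
  rw [← integral_fintype_prod_eq_prod]
  refine integral_congr_ae (ae_of_all _ fun t => ?_)
  simp only [Finset.prod_mul_distrib, ← Complex.exp_sum, ← Finset.mul_sum, inner_sum,
    Complex.ofReal_sum]

theorem prod_conj_extensionOp_eq_integral {n m : ℕ} {γ : ℝ → EuclideanSpace ℝ (Fin n)}
    (A : Fin m → Set ℝ) (f : ℝ → ℂ) (x : EuclideanSpace ℝ (Fin n)) :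
    ∏ i, (starRingEnd ℂ) (extensionOp γ (A i) f x) = ∫ t, Complex.exp (2 * Real.pi * Complex.I *
      (-inner ℝ x (∑ i, γ (t i)) : ℝ)) * ∏ i, (starRingEnd ℂ) (f (t i))
        ∂(Measure.pi fun i => volume.restrict (A i)) := by
  rw [← map_prod, prod_extensionOp_eq_integral, ← integral_conj]
  refine integral_congr_ae (ae_of_all _ fun t => ?_)
  simp only [map_mul, map_prod, ← Complex.exp_conj, Complex.conj_ofReal, Complex.conj_I,
    Complex.ofReal_neg, map_ofNat]
  ring_nf

theorem ae_pi_restrict_mem {m : ℕ} {A : Fin m → Set ℝ} (hA : ∀ i, MeasurableSet (A i)) :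
    ∀ᵐ t ∂(Measure.pi fun i => (volume : Measure ℝ).restrict (A i)), ∀ i, t i ∈ A i := by
  rw [← Measure.restrict_pi_pi]
  filter_upwards [ae_restrict_mem (MeasurableSet.univ_pi hA)] with t ht i
  exact ht i (mem_univ i)

/-- If the frequencies of `∏ E_{A i} f` and `∏ E_{B i} f` differ by more than the support of the
Fourier transform of the weight `K`, then these products are orthogonal with respect to `K`. -/
theorem integral_mul_prod_extensionOp_eq_zero {n m : ℕ} {γ : ℝ → EuclideanSpace ℝ (Fin n)}
    (hγ : Continuous γ) {A B : Fin m → Set ℝ} (hA : ∀ i, MeasurableSet (A i))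
    (hB : ∀ i, MeasurableSet (B i)) {f : ℝ → ℂ} (hfA : ∀ i, IntegrableOn f (A i))
    (hfB : ∀ i, IntegrableOn f (B i)) {K : EuclideanSpace ℝ (Fin n) → ℂ} (hK : Integrable K)
    {η : ℝ} (hKη : ∀ ξ, η ≤ ‖ξ‖ →
      ∫ x, K x * Complex.exp (2 * Real.pi * Complex.I * (inner ℝ x ξ : ℝ)) = 0)
    (hfar : ∀ t s : Fin m → ℝ, (∀ i, t i ∈ A i) → (∀ i, s i ∈ B i) →
      η ≤ ‖∑ i, γ (t i) - ∑ i, γ (s i)‖) :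
    ∫ x, K x * ((∏ i, extensionOp γ (A i) f x) *
      ∏ i, (starRingEnd ℂ) (extensionOp γ (B i) f x)) = 0 := by
  set μ := Measure.pi fun i => (volume : Measure ℝ).restrict (A i) with hμ
  set ν := Measure.pi fun i => (volume : Measure ℝ).restrict (B i) with hν
  have hF : Integrable (fun t : Fin m → ℝ => ∏ i, f (t i)) μ :=
    Integrable.fintype_prod (f := fun _ => f) hfA
  have hG : Integrable (fun t : Fin m → ℝ => ∏ i, (starRingEnd ℂ) (f (t i))) ν :=
    Integrable.fintype_prod (f := fun _ t => (starRingEnd ℂ) (f t)) fun i =>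
      (RCLike.conjCLE (K := ℂ)).integrable_comp_iff.2 (hfB i)
  set e : EuclideanSpace ℝ (Fin n) → (Fin m → ℝ) × (Fin m → ℝ) → ℂ := fun x p =>
    Complex.exp (2 * Real.pi * Complex.I *
      (inner ℝ x (∑ i, γ (p.1 i) - ∑ i, γ (p.2 i)) : ℝ)) with he
  have hprod : ∀ x, (∏ i, extensionOp γ (A i) f x) *
      ∏ i, (starRingEnd ℂ) (extensionOp γ (B i) f x) =
      ∫ p, e x p * ((∏ i, f (p.1 i)) * ∏ i, (starRingEnd ℂ) (f (p.2 i))) ∂(μ.prod ν) := by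
    intro x
    rw [prod_extensionOp_eq_integral, prod_conj_extensionOp_eq_integral, ← integral_prod_mul]
    refine integral_congr_ae (ae_of_all _ fun p => ?_)
    simp only [he]
    rw [inner_sub_right, sub_eq_add_neg, Complex.ofReal_add, mul_add, Complex.exp_add]
    ring
  have hint : Integrable (Function.uncurry fun x p =>
      K x * (e x p * ((∏ i, f (p.1 i)) * ∏ i, (starRingEnd ℂ) (f (p.2 i)))))
      (volume.prod (μ.prod ν)) := by
    have h1 := (hK.mul_prod (hF.mul_prod hG)).bdd_mul (c := 1)
      (f := fun q : EuclideanSpace ℝ (Fin n) × ((Fin m → ℝ) × (Fin m → ℝ)) => e q.1 q.2)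
      (Continuous.aestronglyMeasurable (by simp only [he]; fun_prop))
      (ae_of_all _ fun q => (norm_exp_two_pi_I_mul _).le)
    refine h1.congr (ae_of_all _ fun q => ?_)
    simp only [Function.uncurry]
    ring
  simp only [hprod, ← integral_const_mul]
  -- After Fubini the inner integral is the Fourier integral of `K` at the frequency `∑ γ(t_i) - ∑
  -- γ(s_i)`, where it vanishes.
  rw [integral_integral_swap hint]
  refine integral_eq_zero_of_ae ?_
  filter_upwards [Measure.quasiMeasurePreserving_fst.ae (ae_pi_restrict_mem hA),
    Measure.quasiMeasurePreserving_snd.ae (ae_pi_restrict_mem hB)] with p hp1 hp2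
  have := hKη _ (hfar p.1 p.2 hp1 hp2)
  have h2 : ∀ x, K x * (e x p * ((∏ i, f (p.1 i)) * ∏ i, (starRingEnd ℂ) (f (p.2 i)))) =
      (K x * e x p) * ((∏ i, f (p.1 i)) * ∏ i, (starRingEnd ℂ) (f (p.2 i))) := fun x => by ring
  simp only [h2, integral_mul_const]
  simp only [he, this, zero_mul, Pi.zero_apply]

theorem integral_comp_inv_smul_sub {n : ℕ} {F : Type*} [NormedAddCommGroup F] [NormedSpace ℝ F]
    (g : EuclideanSpace ℝ (Fin n) → F) (y : EuclideanSpace ℝ (Fin n)) {ρ : ℝ} (hρ : 0 < ρ) :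
    ∫ x, g (ρ⁻¹ • (x - y)) = ρ ^ n • ∫ z, g z := by
  rw [integral_sub_right_eq_self (fun x => g (ρ⁻¹ • x)) y,
    Measure.integral_comp_inv_smul]
  simp [abs_of_pos hρ]

/-- Dilating by `ρ` shrinks the frequency support by the factor `ρ`; the translation contributes
only a unimodular factor. -/
theorem integral_scaled_weight_mul_exp_eq_zero {n : ℕ} {φ : EuclideanSpace ℝ (Fin n) → ℝ} {r : ℝ}
    (hφ : ∀ ξ, r ≤ ‖ξ‖ →
      ∫ x, (φ x : ℂ) * Complex.exp (2 * Real.pi * Complex.I * (inner ℝ x ξ : ℝ)) = 0)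
    (y : EuclideanSpace ℝ (Fin n)) {ρ : ℝ} (hρ : 0 < ρ) {ξ : EuclideanSpace ℝ (Fin n)}
    (hξ : r / ρ ≤ ‖ξ‖) :
    ∫ x, (φ (ρ⁻¹ • (x - y)) : ℂ) *
      Complex.exp (2 * Real.pi * Complex.I * (inner ℝ x ξ : ℝ)) = 0 := by
  set g : EuclideanSpace ℝ (Fin n) → ℂ := fun z =>
    (φ z : ℂ) * Complex.exp (2 * Real.pi * Complex.I * (inner ℝ z (ρ • ξ) : ℝ)) with hg
  have h1 : ∀ x, (φ (ρ⁻¹ • (x - y)) : ℂ) *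
      Complex.exp (2 * Real.pi * Complex.I * (inner ℝ x ξ : ℝ)) = g (ρ⁻¹ • (x - y)) *
        Complex.exp (2 * Real.pi * Complex.I * (inner ℝ y ξ : ℝ)) := by
    intro x
    simp only [hg]
    rw [mul_assoc (φ _ : ℂ), ← Complex.exp_add, inner_smul_left, inner_smul_right, inner_sub_left]
    congr 2
    push_cast
    have : (ρ : ℂ) ≠ 0 := by exact_mod_cast hρ.ne'
    simp
    field_simp
    ring
  simp only [h1]
  rw [integral_mul_const, integral_comp_inv_smul_sub g y hρ, hφ, smul_zero, zero_mul]
  rw [norm_smul, Real.norm_of_nonneg hρ.le]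
  rwa [div_le_iff₀' hρ] at hξ

/-! ### Counting nearly permuted tuples -/

/-- Schur's test: an index has at most `2K + 1` neighbours, and `h k * h l` is at most the mean of
the squares. -/
theorem sum_near_mul_le (G : Finset ℕ) (K : ℕ) (h : ℕ → ℝ) :
    ∑ k ∈ G, ∑ l ∈ G, (if k ≤ l + K ∧ l ≤ k + K then h k * h l else 0) ≤
      (2 * K + 1) * ∑ k ∈ G, h k ^ 2 := by
  have hcard : ∀ k : ℕ, (∑ l ∈ G, if k ≤ l + K ∧ l ≤ k + K then (1 : ℝ) else 0) ≤ 2 * K + 1 := by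
    intro k
    rw [Finset.sum_boole]
    have h1 : (G.filter fun l => k ≤ l + K ∧ l ≤ k + K) ⊆ Finset.Icc (k - K) (k + K) := by
      intro l hl
      simp only [Finset.mem_filter, Finset.mem_Icc] at hl ⊢
      omega
    have h2 := Finset.card_le_card h1
    rw [Nat.card_Icc] at h2
    have h3 : (G.filter fun l => k ≤ l + K ∧ l ≤ k + K).card ≤ 2 * K + 1 := by omega
    exact_mod_cast h3
  have hA : ∑ k ∈ G, ∑ l ∈ G, (if k ≤ l + K ∧ l ≤ k + K then h k ^ 2 else 0) ≤
      (2 * K + 1) * ∑ k ∈ G, h k ^ 2 := by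
    rw [Finset.mul_sum]
    refine Finset.sum_le_sum fun k _ => ?_
    have := mul_le_mul_of_nonneg_right (hcard k) (sq_nonneg (h k))
    rw [Finset.sum_mul] at this
    simpa only [ite_mul, one_mul, zero_mul] using this
  have hB : ∑ k ∈ G, ∑ l ∈ G, (if k ≤ l + K ∧ l ≤ k + K then h l ^ 2 else 0) ≤
      (2 * K + 1) * ∑ k ∈ G, h k ^ 2 := by
    rw [Finset.sum_comm]
    simpa only [and_comm] using hA
  have hC : ∑ k ∈ G, ∑ l ∈ G, (if k ≤ l + K ∧ l ≤ k + K then h k * h l else 0) ≤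
      ∑ k ∈ G, ∑ l ∈ G, ((if k ≤ l + K ∧ l ≤ k + K then h k ^ 2 else 0) / 2 +
        (if k ≤ l + K ∧ l ≤ k + K then h l ^ 2 else 0) / 2) := by
    refine Finset.sum_le_sum fun k _ => Finset.sum_le_sum fun l _ => ?_
    split_ifs
    · nlinarith [sq_nonneg (h k - h l)]
    · simp
  simp only [Finset.sum_add_distrib, ← Finset.sum_div] at hC
  linarith

/-- The tuples `a` and `b` agree up to a permutation and shifts by at most `K`. -/
def IsNearPerm {m : ℕ} (K : ℕ) (a b : Fin m → ℕ) : Prop :=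
  ∃ σ : Equiv.Perm (Fin m), ∀ i, a i ≤ b (σ i) + K ∧ b (σ i) ≤ a i + K

open Classical in
-- Union bound over the `m!` permutations. For a fixed one, reindexing `b` makes the double sum
-- factor into the `m`-th power of the sum over neighbouring pairs.
theorem sum_isNearPerm_prod_le {m : ℕ} (G : Finset ℕ) (K : ℕ) {h : ℕ → ℝ} (hh : ∀ k, 0 ≤ h k) :
    ∑ a ∈ Fintype.piFinset fun _ : Fin m => G, ∑ b ∈ Fintype.piFinset fun _ : Fin m => G,
      (if IsNearPerm K a b then (∏ i, h (a i)) * ∏ i, h (b i) else 0) ≤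
    m.factorial * ((2 * K + 1) * ∑ k ∈ G, h k ^ 2) ^ m := by
  set q : ℕ → ℕ → ℝ := fun k l => if k ≤ l + K ∧ l ≤ k + K then h k * h l else 0 with hq
  have hq0 : ∀ k l, 0 ≤ q k l := by
    intro k l
    simp only [hq]
    split_ifs
    exacts [mul_nonneg (hh k) (hh l), le_rfl]
  have hpt : ∀ a b : Fin m → ℕ,
      (if IsNearPerm K a b then (∏ i, h (a i)) * ∏ i, h (b i) else 0) ≤
        ∑ σ : Equiv.Perm (Fin m), ∏ i, q (a i) (b (σ i)) := by
    intro a b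
    split_ifs with hn
    · obtain ⟨σ, hσ⟩ := hn
      refine le_trans (le_of_eq ?_) (Finset.single_le_sum (f := fun σ : Equiv.Perm (Fin m) =>
        ∏ i, q (a i) (b (σ i))) (fun σ _ => Finset.prod_nonneg fun i _ => hq0 _ _)
        (Finset.mem_univ σ))
      rw [← Equiv.prod_comp σ fun i => h (b i), ← Finset.prod_mul_distrib]
      exact Finset.prod_congr rfl fun i _ => (if_pos (hσ i)).symm
    · exact Finset.sum_nonneg fun σ _ => Finset.prod_nonneg fun i _ => hq0 _ _
  have hσ : ∀ σ : Equiv.Perm (Fin m),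
      ∑ a ∈ Fintype.piFinset fun _ : Fin m => G, ∑ b ∈ Fintype.piFinset fun _ : Fin m => G,
        ∏ i, q (a i) (b (σ i)) = (∑ k ∈ G, ∑ l ∈ G, q k l) ^ m := by
    intro σ
    have h1 : (∑ k ∈ G, ∑ l ∈ G, q k l) ^ m = ∏ _i : Fin m, ∑ k ∈ G, ∑ l ∈ G, q k l := by simp
    rw [h1, Finset.prod_univ_sum]
    refine Finset.sum_congr rfl fun a _ => ?_
    rw [Finset.prod_univ_sum]
    refine Finset.sum_nbij' (fun b => b ∘ σ) (fun b => b ∘ σ.symm) ?_ ?_ ?_ ?_ ?_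
    · intro b hb
      simp only [Fintype.mem_piFinset] at hb ⊢
      exact fun i => hb _
    · intro b hb
      simp only [Fintype.mem_piFinset] at hb ⊢
      exact fun i => hb _
    · intro b _; ext i; simp
    · intro b _; ext i; simp
    · intro b _; rfl
  calc _ ≤ ∑ a ∈ Fintype.piFinset fun _ : Fin m => G, ∑ b ∈ Fintype.piFinset fun _ : Fin m => G,
        ∑ σ : Equiv.Perm (Fin m), ∏ i, q (a i) (b (σ i)) :=
        Finset.sum_le_sum fun a _ => Finset.sum_le_sum fun b _ => hpt a b
    _ = ∑ σ : Equiv.Perm (Fin m), ∑ a ∈ Fintype.piFinset fun _ : Fin m => G,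
        ∑ b ∈ Fintype.piFinset fun _ : Fin m => G, ∏ i, q (a i) (b (σ i)) :=
        (Finset.sum_comm.trans (Finset.sum_congr rfl fun a _ => Finset.sum_comm)).symm
    _ = m.factorial * (∑ k ∈ G, ∑ l ∈ G, q k l) ^ m := by
        rw [Finset.sum_congr rfl fun σ _ => hσ σ, Finset.sum_const, Finset.card_univ,
          Fintype.card_perm, Fintype.card_fin, nsmul_eq_mul]
    _ ≤ _ := by
        refine mul_le_mul_of_nonneg_left (pow_le_pow_left₀ ?_ (sum_near_mul_le G K h) m)
          (Nat.cast_nonneg _)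
        exact Finset.sum_nonneg fun k _ => Finset.sum_nonneg fun l _ => hq0 k l

theorem norm_sum_pow_eq_sum_prod (G : Finset ℕ) (F : ℕ → ℂ) (m : ℕ) :
    ((‖∑ k ∈ G, F k‖ ^ (2 * m) : ℝ) : ℂ) =
      ∑ a ∈ Fintype.piFinset fun _ : Fin m => G, ∑ b ∈ Fintype.piFinset fun _ : Fin m => G,
        (∏ i, F (a i)) * ∏ i, (starRingEnd ℂ) (F (b i)) := by
  rw [pow_mul, Complex.ofReal_pow, Complex.ofReal_pow, ← Complex.mul_conj', mul_pow,
    ← Finset.sum_mul_sum, map_sum]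
  have h1 : ∀ z : ℂ, z ^ m = ∏ _i : Fin m, z := fun z => by simp
  rw [h1, h1, Finset.prod_univ_sum, Finset.prod_univ_sum]

/-- If only products over nearly permuted tuples contribute, then the `L^{2m}` norm is controlled by
that of the square function. -/
theorem integral_norm_sum_pow_le_of_orthogonal {X : Type*} [TopologicalSpace X] [MeasurableSpace X]
    [OpensMeasurableSpace X] {μ : Measure X} {m : ℕ} (G : Finset ℕ) (K : ℕ) {F : ℕ → X → ℂ}
    (hF : ∀ k, Continuous (F k)) {M : ℝ} (hM : ∀ k x, ‖F k x‖ ≤ M) {W : X → ℝ}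
    (hW0 : ∀ x, 0 ≤ W x) (hW : Integrable W μ)
    (horth : ∀ a b : Fin m → ℕ, (∀ i, a i ∈ G) → (∀ i, b i ∈ G) → ¬ IsNearPerm K a b →
      ∫ x, (W x : ℂ) * ((∏ i, F (a i) x) * ∏ i, (starRingEnd ℂ) (F (b i) x)) ∂μ = 0) :
    ∫ x, W x * ‖∑ k ∈ G, F k x‖ ^ (2 * m) ∂μ ≤
      m.factorial * (2 * K + 1) ^ m * ∫ x, W x * (∑ k ∈ G, ‖F k x‖ ^ 2) ^ m ∂μ := by
  classical
  set P : (Fin m → ℕ) → (Fin m → ℕ) → X → ℂ := fun a b x =>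
    (∏ i, F (a i) x) * ∏ i, (starRingEnd ℂ) (F (b i) x) with hP
  have hPn : ∀ a b x, ‖P a b x‖ = (∏ i, ‖F (a i) x‖) * ∏ i, ‖F (b i) x‖ := by
    intro a b x
    simp only [hP, norm_mul, norm_prod, RCLike.norm_conj]
  have hPc : ∀ a b, Continuous (P a b) := by
    intro a b
    simp only [hP]
    fun_prop
  have hWc : Integrable (fun x => (W x : ℂ)) μ := hW.ofReal
  have hPi : ∀ a b, Integrable (fun x => (W x : ℂ) * P a b x) μ := by
    intro a b
    refine hWc.mul_bdd (c := M ^ m * M ^ m) (hPc a b).aestronglyMeasurable (ae_of_all _ fun x => ?_)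
    rw [hPn]
    have hb : ∀ c : Fin m → ℕ, ∏ i, ‖F (c i) x‖ ≤ M ^ m := fun c =>
      (Finset.prod_le_prod (fun _ _ => norm_nonneg _) fun i _ => hM (c i) x).trans_eq (by simp)
    exact mul_le_mul (hb a) (hb b) (Finset.prod_nonneg fun _ _ => norm_nonneg _)
      ((Finset.prod_nonneg fun _ _ => norm_nonneg _).trans (hb a))
  -- The vanishing terms disappear only after integration; the remaining ones are put back under the
  -- integral so that they can be bounded pointwise.
  have h1 : ((∫ x, W x * ‖∑ k ∈ G, F k x‖ ^ (2 * m) ∂μ : ℝ) : ℂ) =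
      ∫ x, (W x : ℂ) * ∑ a ∈ Fintype.piFinset fun _ : Fin m => G,
        ∑ b ∈ Fintype.piFinset fun _ : Fin m => G, (if IsNearPerm K a b then P a b x else 0) ∂μ := by
    refine integral_complex_ofReal.symm.trans ?_
    have hpt : ∀ x, ((W x * ‖∑ k ∈ G, F k x‖ ^ (2 * m) : ℝ) : ℂ) =
        ∑ a ∈ Fintype.piFinset fun _ : Fin m => G, ∑ b ∈ Fintype.piFinset fun _ : Fin m => G,
          (W x : ℂ) * P a b x := by
      intro x
      rw [Complex.ofReal_mul, norm_sum_pow_eq_sum_prod]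
      simp only [Finset.mul_sum, hP]
    simp only [hpt, Finset.mul_sum]
    rw [integral_finsetSum _ fun a _ => integrable_finsetSum _ fun b _ => hPi a b,
      integral_finsetSum]
    · refine Finset.sum_congr rfl fun a ha => ?_
      rw [integral_finsetSum _ fun b _ => hPi a b, integral_finsetSum]
      · refine Finset.sum_congr rfl fun b hb => ?_
        split_ifs with hn
        · rfl
        · rw [Fintype.mem_piFinset] at ha hb
          rw [horth a b ha hb hn]; simp
      · intro b _
        split_ifs
        · exact hPi a b
        · simp
    · intro a _
      refine integrable_finsetSum _ fun b _ => ?_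
      split_ifs
      · exact hPi a b
      · simp
  have hM0 : ∀ x, ∑ k ∈ G, ‖F k x‖ ^ 2 ≤ G.card * M ^ 2 := by
    intro x
    rw [← nsmul_eq_mul]
    exact Finset.sum_le_card_nsmul _ _ _ fun k _ => pow_le_pow_left₀ (norm_nonneg _) (hM k x) 2
  have hS : Integrable (fun x => W x * (∑ k ∈ G, ‖F k x‖ ^ 2) ^ m) μ := by
    refine hW.mul_bdd (c := (G.card * M ^ 2) ^ m)
      (Continuous.aestronglyMeasurable (by fun_prop)) (ae_of_all _ fun x => ?_)
    rw [Real.norm_of_nonneg (by positivity)]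
    exact pow_le_pow_left₀ (by positivity) (hM0 x) m
  have h0 : 0 ≤ ∫ x, W x * ‖∑ k ∈ G, F k x‖ ^ (2 * m) ∂μ :=
    integral_nonneg fun x => mul_nonneg (hW0 x) (by positivity)
  have h2 := congrArg norm h1
  rw [Complex.norm_real, Real.norm_of_nonneg h0] at h2
  rw [h2, ← integral_const_mul]
  refine norm_integral_le_of_norm_le (hS.const_mul _) (ae_of_all _ fun x => ?_)
  rw [norm_mul, Complex.norm_real, Real.norm_of_nonneg (hW0 x)]
  have h3 : ‖∑ a ∈ Fintype.piFinset fun _ : Fin m => G,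
      ∑ b ∈ Fintype.piFinset fun _ : Fin m => G, (if IsNearPerm K a b then P a b x else 0)‖ ≤
      m.factorial * ((2 * K + 1) * ∑ k ∈ G, ‖F k x‖ ^ 2) ^ m := by
    refine le_trans ?_ (sum_isNearPerm_prod_le G K (h := fun k => ‖F k x‖) fun k => norm_nonneg _)
    refine (norm_sum_le _ _).trans (Finset.sum_le_sum fun a _ => ?_)
    refine (norm_sum_le _ _).trans (Finset.sum_le_sum fun b _ => ?_)
    split_ifs
    · exact (hPn a b x).le
    · simp
  calc _ ≤ W x * (m.factorial * ((2 * K + 1) * ∑ k ∈ G, ‖F k x‖ ^ 2) ^ m) :=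
        mul_le_mul_of_nonneg_left h3 (hW0 x)
    _ = _ := by rw [mul_pow]; ring

/-! ### The dissection and the estimate for the band-limited weight -/

theorem dissectionInterval_subset (R : ℝ) (l : ℕ) : dissectionInterval R l ⊆ Icc 0 1 :=
  inter_subset_right

theorem measurableSet_dissectionInterval (R : ℝ) (l : ℕ) :
    MeasurableSet (dissectionInterval R l) :=
  measurableSet_Icc.inter measurableSet_Icc

theorem setIntegral_eq_sum_dissectionInterval {R : ℝ} (hR : 0 < R) {g : ℝ → ℂ}
    (hg : IntegrableOn g (Icc 0 1)) :
    ∫ t in Icc 0 1, g t = ∑ l ∈ Finset.range ⌈R⌉₊, ∫ t in dissectionInterval R l, g t := by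
  -- Half-open versions, equal up to null sets, partition `[0,1)`: `x` lies in the one of index `⌊x
  -- * R⌋₊`.
  set J : ℕ → Set ℝ := fun l => Ico ((l : ℝ) / R) (((l : ℝ) + 1) / R) ∩ Ico 0 1 with hJ
  have h1 : ∀ l, ∫ t in dissectionInterval R l, g t = ∫ t in J l, g t := fun l =>
    setIntegral_congr_set ((Ico_ae_eq_Icc.inter Ico_ae_eq_Icc).symm)
  have hU : ⋃ l ∈ Finset.range ⌈R⌉₊, J l = Ico 0 1 := by
    ext x
    simp only [mem_iUnion, Finset.mem_range, exists_prop, hJ, mem_inter_iff]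
    refine ⟨fun ⟨_, _, _, h⟩ => h, fun h => ⟨⌊x * R⌋₊, ?_, ?_, h⟩⟩
    · rw [Nat.lt_ceil]
      refine (Nat.floor_le (mul_nonneg h.1 hR.le)).trans_lt ?_
      nlinarith [h.2]
    · rw [mem_Ico, div_le_iff₀ hR, lt_div_iff₀ hR]
      exact ⟨Nat.floor_le (mul_nonneg h.1 hR.le), Nat.lt_floor_add_one _⟩
  simp only [h1]
  rw [← integral_biUnion_finset, hU]
  · exact (setIntegral_congr_set Ico_ae_eq_Icc).symm
  · exact fun l _ => measurableSet_Ico.inter measurableSet_Ico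
  · have key : ∀ k l : ℕ, k < l → Disjoint (J k) (J l) := by
      intro k l hkl
      refine Set.disjoint_left.2 fun x hx hy => ?_
      have h2 := hx.1.2
      have h3 := hy.1.1
      have h4 : ((k : ℝ) + 1) / R ≤ l / R := by
        have : (k : ℝ) + 1 ≤ l := by exact_mod_cast hkl
        gcongr
      linarith
    intro k _ l _ hkl
    rcases lt_or_gt_of_ne hkl with h | h
    exacts [key k l h, (key l k h).symm]
  · exact fun l _ => hg.mono_set (inter_subset_right.trans Ico_subset_Icc_self)

theorem extensionOp_eq_sum {n : ℕ} {γ : ℝ → EuclideanSpace ℝ (Fin n)} (hγ : Continuous γ) {R : ℝ}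
    (hR : 0 < R) {f : ℝ → ℂ} (hf : IntegrableOn f (Icc 0 1)) (x : EuclideanSpace ℝ (Fin n)) :
    extensionOp γ (Icc 0 1) f x =
      ∑ l ∈ Finset.range ⌈R⌉₊, extensionOp γ (dissectionInterval R l) f x :=
  setIntegral_eq_sum_dissectionInterval hR (integrableOn_exp_mul hγ hf x)

/-- The conclusion of `IsNondegenerateCurve.exists_matching`, as a property of a curve. -/
def HasMatching {n : ℕ} (γ : ℝ → EuclideanSpace ℝ (Fin n)) (C δ : ℝ) : Prop :=
  ∀ m ≤ n, ∀ a b : ℝ, 0 ≤ a → b ≤ 1 → b - a ≤ δ → ∀ t s : Fin m → ℝ,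
    (∀ i, t i ∈ Icc a b) → (∀ i, s i ∈ Icc a b) → ∃ σ : Equiv.Perm (Fin m),
    ∀ i, |t i - s (σ i)| ^ n ≤ C * ‖∑ j, γ (t j) - ∑ j, γ (s j)‖

/-- By contraposition: sums closer than `r/ρ ≤ r * R^(-n)` force matched points to be `O(1/R)`
apart, hence matched indices to be `O(1)` apart. The common value `j` keeps all the points in one
interval of length `δ`, where matching applies. -/
theorem HasMatching.le_norm_sub_of_not_isNearPerm {n : ℕ} (hn : 1 ≤ n)
    {γ : ℝ → EuclideanSpace ℝ (Fin n)} {C δ : ℝ} (hC : 0 < C) (hδ : 0 < δ)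
    (hmatch : HasMatching γ C δ) {r : ℝ} (hr : 0 < r) {m : ℕ} (hmn : m ≤ n) {R ρ : ℝ} (hR : 1 ≤ R)
    (hρ : R ^ n ≤ ρ) {j : ℕ} {a b : Fin m → ℕ} (ha : ∀ i, ⌊(a i : ℝ) / (R * (δ / 2))⌋₊ = j)
    (hb : ∀ i, ⌊(b i : ℝ) / (R * (δ / 2))⌋₊ = j) (hab : ¬ IsNearPerm (⌈C * r⌉₊ + 2) a b)
    {t s : Fin m → ℝ} (ht : ∀ i, t i ∈ dissectionInterval R (a i))
    (hs : ∀ i, s i ∈ dissectionInterval R (b i)) :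
    r / ρ ≤ ‖∑ i, γ (t i) - ∑ i, γ (s i)‖ := by
  have hR0 : 0 < R := by linarith
  have hRn : 0 < R ^ n := by positivity
  have hρ0 : 0 < ρ := hRn.trans_le hρ
  have hd : 0 < δ / 2 := by positivity
  have hRd : 0 < R * (δ / 2) := by positivity
  have hfl : ∀ k : ℕ, ⌊(k : ℝ) / (R * (δ / 2))⌋₊ = j →
      j * (R * (δ / 2)) ≤ k ∧ (k : ℝ) < (j + 1) * (R * (δ / 2)) := by
    intro k hk
    rw [Nat.floor_eq_iff (by positivity), le_div_iff₀ hRd, div_lt_iff₀ hRd] at hk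
    exact hk
  by_contra! hlt
  refine hab ?_
  -- If `R * (δ / 2) ≤ 1`, a group contains at most one index. Otherwise `1/R < δ/2`, and a group of
  -- left endpoints spread over `δ/2` stays within length `δ` after adding an interval.
  rcases le_or_gt (R * (δ / 2)) 1 with hsmall | hbig
  · refine ⟨Equiv.refl _, fun i => ?_⟩
    obtain ⟨h1, h2⟩ := hfl _ (ha i)
    obtain ⟨h3, h4⟩ := hfl _ (hb i)
    have h5 : (a i : ℝ) < b i + 1 := by linarith
    have h6 : (b i : ℝ) < a i + 1 := by linarith
    have h5' : a i < b i + 1 := by exact_mod_cast h5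
    have h6' : b i < a i + 1 := by exact_mod_cast h6
    simp only [Equiv.refl_apply]
    omega
  have hJ : ∀ k : ℕ, ⌊(k : ℝ) / (R * (δ / 2))⌋₊ = j → ∀ u ∈ dissectionInterval R k,
      u ∈ Icc (j * (δ / 2)) (min 1 (j * (δ / 2) + δ)) := by
    intro k hk u hu
    obtain ⟨h1, h2⟩ := hfl k hk
    obtain ⟨⟨hu1, hu2⟩, hu3, hu4⟩ := hu
    rw [div_le_iff₀ hR0] at hu1
    rw [le_div_iff₀ hR0] at hu2
    refine ⟨?_, le_min hu4 ?_⟩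
    · refine le_of_mul_le_mul_right ?_ hR0
      linarith
    · refine le_of_mul_le_mul_right ?_ hR0
      linarith
  obtain ⟨σ, hσ⟩ := hmatch m hmn (j * (δ / 2)) (min 1 (j * (δ / 2) + δ)) (by positivity)
    (min_le_left _ _) (by linarith [min_le_right 1 (j * (δ / 2) + δ)]) t s
    (fun i => hJ _ (ha i) _ (ht i)) (fun i => hJ _ (hb i) _ (hs i))
  refine ⟨σ, fun i => ?_⟩
  -- The `1` covers the case where `R * |t i - s (σ i)|` is at most `1`; a larger number is bounded
  -- by its `n`-th power. Locating the two points in their intervals costs one more, hence `⌈C * r⌉₊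
  -- + 2`.
  have hclose : R * |t i - s (σ i)| ≤ C * r + 1 := by
    by_contra! hgt
    have h1 : (R * |t i - s (σ i)|) ^ n ≤ C * r := by
      rw [mul_pow]
      calc R ^ n * |t i - s (σ i)| ^ n ≤ R ^ n * (C * (r / ρ)) := by
            refine mul_le_mul_of_nonneg_left ((hσ i).trans ?_) hRn.le
            exact mul_le_mul_of_nonneg_left hlt.le hC.le
        _ = (C * r) * (R ^ n / ρ) := by ring
        _ ≤ C * r := mul_le_of_le_one_right (by positivity) ((div_le_one hρ0).2 hρ)
    have h2 : R * |t i - s (σ i)| ≤ (R * |t i - s (σ i)|) ^ n :=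
      le_self_pow₀ (by nlinarith [mul_pos hC hr]) (by omega)
    linarith
  have hK : C * r ≤ ⌈C * r⌉₊ := Nat.le_ceil _
  obtain ⟨⟨ht1, ht2⟩, -⟩ := ht i
  obtain ⟨⟨hs1, hs2⟩, -⟩ := hs (σ i)
  rw [div_le_iff₀ hR0] at ht1 hs1
  rw [le_div_iff₀ hR0] at ht2 hs2
  have h3 := mul_le_mul_of_nonneg_left (le_abs_self (t i - s (σ i))) hR0.le
  have h4 := mul_le_mul_of_nonneg_left (neg_abs_le (t i - s (σ i))) hR0.le
  constructor
  · have : (a i : ℝ) ≤ b (σ i) + (⌈C * r⌉₊ + 2) := by linarith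
    exact_mod_cast this
  · have : (b (σ i) : ℝ) ≤ a i + (⌈C * r⌉₊ + 2) := by linarith
    exact_mod_cast this

/-- Orthogonality is available only within a group of indices of length about `R * δ / 2`. The
number `N` of groups does not depend on `R`, so the power mean inequality costs a constant. -/
theorem HasMatching.integral_norm_extensionOp_pow_le {n : ℕ} (hn : 1 ≤ n)
    {γ : ℝ → EuclideanSpace ℝ (Fin n)} (hγ : Continuous γ) {C δ : ℝ} (hC : 0 < C) (hδ : 0 < δ)
    (hmatch : HasMatching γ C δ) {φ : EuclideanSpace ℝ (Fin n) → ℝ}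
    (hφ0 : ∀ x, 0 ≤ φ x) (hφi : Integrable φ) {r : ℝ} (hr : 0 < r) (hφr : ∀ ξ, r ≤ ‖ξ‖ →
      ∫ x, (φ x : ℂ) * Complex.exp (2 * Real.pi * Complex.I * (inner ℝ x ξ : ℝ)) = 0) :
    ∃ C' : ℝ, 1 ≤ C' ∧ ∀ m : ℕ, 1 ≤ m → m ≤ n → ∀ R ρ : ℝ, 1 ≤ R → R ^ n ≤ ρ →
      ∀ (y : EuclideanSpace ℝ (Fin n)) (f : ℝ → ℂ), IntegrableOn f (Icc 0 1) →
        ∫ x, φ (ρ⁻¹ • (x - y)) * ‖extensionOp γ (Icc 0 1) f x‖ ^ (2 * m) ≤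
          C' * ∫ x, φ (ρ⁻¹ • (x - y)) * squareFunction γ R f x ^ (2 * m) := by
  set K : ℕ := ⌈C * r⌉₊ + 2 with hK
  -- Indices satisfy `l < R`, so `l / (R * (δ / 2))` stays below `(δ / 2)⁻¹`.
  set N : ℕ := ⌊(δ / 2)⁻¹⌋₊ + 1 with hN
  have hN1 : (1 : ℝ) ≤ N := by rw [hN]; push_cast; linarith [Nat.cast_nonneg (α := ℝ) ⌊(δ / 2)⁻¹⌋₊]
  have hK1 : (1 : ℝ) ≤ 2 * K + 1 := by linarith [Nat.cast_nonneg (α := ℝ) K]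
  have hf1 : (1 : ℝ) ≤ n.factorial := by exact_mod_cast Nat.one_le_iff_ne_zero.2 n.factorial_ne_zero
  refine ⟨N ^ (2 * n) * (n.factorial * (2 * K + 1) ^ n),
    one_le_mul_of_one_le_of_one_le (one_le_pow₀ hN1)
      (one_le_mul_of_one_le_of_one_le hf1 (one_le_pow₀ hK1)), ?_⟩
  intro m hm hmn R ρ hR hρ y f hf
  have hR0 : 0 < R := by linarith
  have hρ0 : 0 < ρ := lt_of_lt_of_le (by positivity) hρ
  set W : EuclideanSpace ℝ (Fin n) → ℝ := fun x => φ (ρ⁻¹ • (x - y)) with hW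
  have hW0 : ∀ x, 0 ≤ W x := fun x => hφ0 _
  have hWi : Integrable W := (hφi.comp_smul (inv_ne_zero hρ0.ne')).comp_sub_right y
  set F : ℕ → EuclideanSpace ℝ (Fin n) → ℂ := fun l => extensionOp γ (dissectionInterval R l) f
    with hF
  have hfl : ∀ l, IntegrableOn f (dissectionInterval R l) := fun l =>
    hf.mono_set (dissectionInterval_subset R l)
  have hFc : ∀ l, Continuous (F l) := fun l => continuous_extensionOp hγ (hfl l)
  have hFM : ∀ l x, ‖F l x‖ ≤ ∫ t in Icc 0 1, ‖f t‖ := fun l x =>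
    (norm_extensionOp_le _ _ _ _).trans (setIntegral_mono_set hf.norm
      (ae_of_all _ fun _ => norm_nonneg _) (dissectionInterval_subset R l).eventuallyLE)
  set q : ℕ → ℕ := fun l => ⌊(l : ℝ) / (R * (δ / 2))⌋₊ with hq
  set G : ℕ → Finset ℕ := fun j => (Finset.range ⌈R⌉₊).filter fun l => q l = j with hG
  have hqN : ∀ l ∈ Finset.range ⌈R⌉₊, q l ∈ Finset.range N := by
    intro l hl
    rw [Finset.mem_range, Nat.lt_ceil] at hl
    rw [Finset.mem_range, hN, Nat.lt_succ_iff]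
    refine Nat.floor_mono ?_
    rw [div_le_iff₀ (by positivity)]
    have : (δ / 2)⁻¹ * (R * (δ / 2)) = R := by field_simp
    rw [this]
    exact hl.le
  set S : EuclideanSpace ℝ (Fin n) → ℝ := fun x => ∑ l ∈ Finset.range ⌈R⌉₊, ‖F l x‖ ^ 2 with hS
  have hSsq : ∀ x, squareFunction γ R f x ^ (2 * m) = S x ^ m := by
    intro x
    rw [pow_mul, squareFunction, Real.sq_sqrt (Finset.sum_nonneg fun _ _ => by positivity)]
  have hbound : ∀ (T : EuclideanSpace ℝ (Fin n) → ℝ), Continuous T → (∃ M, ∀ x, ‖T x‖ ≤ M) →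
      Integrable fun x => W x * T x := by
    rintro T hT ⟨M, hM⟩
    exact hWi.mul_bdd (c := M) hT.aestronglyMeasurable (ae_of_all _ hM)
  set M : ℝ := ∫ t in Icc 0 1, ‖f t‖ with hMdef
  have hSG : ∀ H : Finset ℕ, Integrable fun x => W x * (∑ l ∈ H, ‖F l x‖ ^ 2) ^ m := by
    intro H
    refine hbound _ (by fun_prop) ⟨(∑ l ∈ H, M ^ 2) ^ m, fun x => ?_⟩
    rw [Real.norm_of_nonneg (by positivity)]
    exact pow_le_pow_left₀ (by positivity)
      (Finset.sum_le_sum fun l _ => pow_le_pow_left₀ (norm_nonneg _) (hFM l x) 2) m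
  have hZG : ∀ H : Finset ℕ, Integrable fun x => W x * ‖∑ l ∈ H, F l x‖ ^ (2 * m) := by
    intro H
    refine hbound _ (by fun_prop) ⟨(∑ l ∈ H, M) ^ (2 * m), fun x => ?_⟩
    rw [Real.norm_of_nonneg (by positivity)]
    exact pow_le_pow_left₀ (by positivity)
      ((norm_sum_le _ _).trans (Finset.sum_le_sum fun l _ => hFM l x)) _
  have hgroup : ∀ j, ∫ x, W x * ‖∑ l ∈ G j, F l x‖ ^ (2 * m) ≤
      n.factorial * (2 * K + 1) ^ n * ∫ x, W x * S x ^ m := by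
    intro j
    have h1 := integral_norm_sum_pow_le_of_orthogonal (m := m) (G j) K hFc hFM hW0 hWi (by
      intro a b ha hb hab
      refine integral_mul_prod_extensionOp_eq_zero (η := r / ρ) hγ
        (fun i => measurableSet_dissectionInterval R (a i))
        (fun i => measurableSet_dissectionInterval R (b i)) (fun i => hfl _) (fun i => hfl _)
        hWi.ofReal (fun ξ hξ => integral_scaled_weight_mul_exp_eq_zero hφr y hρ0 hξ)
        (fun t s ht hs => hmatch.le_norm_sub_of_not_isNearPerm hn hC hδ hr hmn hR hρ (j := j)
          (fun i => (Finset.mem_filter.1 (ha i)).2) (fun i => (Finset.mem_filter.1 (hb i)).2)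
          hab ht hs))
    have h2 : ∫ x, W x * (∑ l ∈ G j, ‖F l x‖ ^ 2) ^ m ≤ ∫ x, W x * S x ^ m := by
      refine integral_mono (hSG _) (hSG _) fun x => mul_le_mul_of_nonneg_left ?_ (hW0 x)
      refine pow_le_pow_left₀ (by positivity) ?_ m
      exact Finset.sum_le_sum_of_subset_of_nonneg (Finset.filter_subset _ _)
        fun _ _ _ => by positivity
    have h3 : (0 : ℝ) ≤ ∫ x, W x * S x ^ m :=
      integral_nonneg fun x => mul_nonneg (hW0 x) (by positivity)
    refine h1.trans (mul_le_mul ?_ h2 ?_ (by positivity))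
    · refine mul_le_mul ?_ (pow_le_pow_right₀ hK1 hmn) (by positivity) (by positivity)
      exact_mod_cast Nat.factorial_le hmn
    · exact integral_nonneg fun x => mul_nonneg (hW0 x) (by positivity)
  have hpt : ∀ x, W x * ‖extensionOp γ (Icc 0 1) f x‖ ^ (2 * m) ≤
      N ^ (2 * m - 1) * ∑ j ∈ Finset.range N, W x * ‖∑ l ∈ G j, F l x‖ ^ (2 * m) := by
    intro x
    rw [extensionOp_eq_sum hγ hR0 hf, ← Finset.mul_sum, mul_left_comm]
    refine mul_le_mul_of_nonneg_left ?_ (hW0 x)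
    have h1 : ∑ l ∈ Finset.range ⌈R⌉₊, F l x = ∑ j ∈ Finset.range N, ∑ l ∈ G j, F l x :=
      (Finset.sum_fiberwise_of_maps_to hqN _).symm
    change ‖∑ l ∈ Finset.range ⌈R⌉₊, F l x‖ ^ (2 * m) ≤ _
    rw [h1]
    refine (pow_le_pow_left₀ (norm_nonneg _) (norm_sum_le _ _) _).trans ?_
    have := pow_sum_le_card_mul_sum_pow (s := Finset.range N)
      (f := fun j => ‖∑ l ∈ G j, F l x‖) (fun _ _ => norm_nonneg _) (2 * m - 1)
    rwa [Nat.sub_add_cancel (by omega), Finset.card_range] at this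
  have hlhs : Integrable fun x => W x * ‖extensionOp γ (Icc 0 1) f x‖ ^ (2 * m) := by
    have := hZG (Finset.range ⌈R⌉₊)
    simpa only [extensionOp_eq_sum hγ hR0 hf] using this
  have hI0 : (0 : ℝ) ≤ ∫ x, W x * S x ^ m :=
    integral_nonneg fun x => mul_nonneg (hW0 x) (by positivity)
  simp only [hSsq]
  calc ∫ x, W x * ‖extensionOp γ (Icc 0 1) f x‖ ^ (2 * m)
      ≤ ∫ x, N ^ (2 * m - 1) * ∑ j ∈ Finset.range N, W x * ‖∑ l ∈ G j, F l x‖ ^ (2 * m) :=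
        integral_mono hlhs ((integrable_finsetSum _ fun j _ => hZG (G j)).const_mul _) hpt
    _ = N ^ (2 * m - 1) * ∑ j ∈ Finset.range N, ∫ x, W x * ‖∑ l ∈ G j, F l x‖ ^ (2 * m) := by
        rw [integral_const_mul, integral_finsetSum _ fun j _ => hZG (G j)]
    _ ≤ N ^ (2 * m - 1) * ∑ j ∈ Finset.range N,
          (n.factorial * (2 * K + 1) ^ n * ∫ x, W x * S x ^ m) := by
        refine mul_le_mul_of_nonneg_left (Finset.sum_le_sum fun j _ => hgroup j) (by positivity)
    _ = N ^ (2 * m) * (n.factorial * (2 * K + 1) ^ n) * ∫ x, W x * S x ^ m := by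
        rw [Finset.sum_const, Finset.card_range, nsmul_eq_mul]
        have : (N : ℝ) ^ (2 * m) = N ^ (2 * m - 1) * N := by
          rw [← pow_succ, Nat.sub_add_cancel (by omega)]
        rw [this]
        ring
    _ ≤ _ := by
        refine mul_le_mul_of_nonneg_right ?_ hI0
        refine mul_le_mul_of_nonneg_right ?_ (by positivity)
        exact pow_le_pow_right₀ hN1 (by omega)

/-! ### From the band-limited weight to the weight of a ball -/

theorem ballWeight_nonneg {n : ℕ} (E : ℝ) (x₀ : EuclideanSpace ℝ (Fin n)) {ρ : ℝ} (hρ : 0 < ρ)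
    (x : EuclideanSpace ℝ (Fin n)) : 0 ≤ ballWeight E x₀ ρ x :=
  Real.rpow_nonneg (by positivity) _

theorem continuous_ballWeight {n : ℕ} (E : ℝ) (x₀ : EuclideanSpace ℝ (Fin n)) {ρ : ℝ}
    (hρ : 0 < ρ) : Continuous (ballWeight E x₀ ρ) :=
  Continuous.rpow_const (by fun_prop) fun x => Or.inl (by positivity)

/-- The weight varies slowly at scale `ρ`: combine the triangle inequality with `1 + a + b ≤ (1 + a)
* (1 + b)`. -/
theorem ballWeight_mul_le {n : ℕ} {E : ℝ} (hE : 0 ≤ E) (x₀ : EuclideanSpace ℝ (Fin n)) {ρ : ℝ}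
    (hρ : 0 < ρ) (x y : EuclideanSpace ℝ (Fin n)) :
    ballWeight E x₀ ρ x * (1 + ‖ρ⁻¹ • (x - y)‖) ^ (-E) ≤ ballWeight E x₀ ρ y := by
  have h1 : ‖ρ⁻¹ • (x - y)‖ = ρ⁻¹ * ‖x - y‖ := by
    rw [norm_smul, Real.norm_of_nonneg (by positivity)]
  rw [ballWeight, ballWeight, h1, ← Real.mul_rpow (by positivity) (by positivity)]
  refine Real.rpow_le_rpow_of_nonpos (by positivity) ?_ (by linarith)
  have h2 : ‖y - x₀‖ ≤ ‖x - x₀‖ + ‖x - y‖ := by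
    have := norm_sub_le (x - x₀) (x - y)
    rwa [show x - x₀ - (x - y) = y - x₀ by abel] at this
  have h3 : ρ⁻¹ * ‖y - x₀‖ ≤ ρ⁻¹ * ‖x - x₀‖ + ρ⁻¹ * ‖x - y‖ := by
    rw [← mul_add]
    exact mul_le_mul_of_nonneg_left h2 (by positivity)
  have h4 : 0 ≤ (ρ⁻¹ * ‖x - x₀‖) * (ρ⁻¹ * ‖x - y‖) := by positivity
  linarith

theorem ballWeight_le_mul {n : ℕ} {E : ℝ} (hE : 0 ≤ E) (x₀ : EuclideanSpace ℝ (Fin n)) {ρ : ℝ}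
    (hρ : 0 < ρ) (x y : EuclideanSpace ℝ (Fin n)) :
    ballWeight E x₀ ρ y ≤ ballWeight E x₀ ρ x * (1 + ‖ρ⁻¹ • (x - y)‖) ^ E := by
  have h := ballWeight_mul_le hE x₀ hρ y x
  have h1 : ‖ρ⁻¹ • (y - x)‖ = ‖ρ⁻¹ • (x - y)‖ := by rw [norm_smul, norm_smul, norm_sub_rev]
  rw [h1, Real.rpow_neg (by positivity), ← div_eq_mul_inv, div_le_iff₀ (by positivity)] at h
  exact h

theorem lintegral_ofReal_comp_inv_smul_sub {n : ℕ} {h : EuclideanSpace ℝ (Fin n) → ℝ}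
    (h0 : ∀ z, 0 ≤ h z) (hi : Integrable h) (x : EuclideanSpace ℝ (Fin n)) {ρ : ℝ} (hρ : 0 < ρ) :
    ∫⁻ y, ENNReal.ofReal (h (ρ⁻¹ • (x - y))) = ENNReal.ofReal (ρ ^ n * ∫ z, h z) := by
  have h1 : Integrable fun y => h (ρ⁻¹ • (x - y)) :=
    (hi.comp_smul (inv_ne_zero hρ.ne')).comp_sub_left x
  rw [← ofReal_integral_eq_lintegral_ofReal h1 (ae_of_all _ fun y => h0 _)]
  congr 1
  rw [integral_sub_left_eq_self (fun z => h (ρ⁻¹ • z)) volume x]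
  have := integral_comp_inv_smul_sub h 0 hρ
  simpa using this

/-- An inequality for all translates of a rapidly decaying weight passes to the polynomially
decaying weight of a ball. -/
theorem lintegral_ballWeight_mul_le {n : ℕ} {E : ℝ} (hE : 0 ≤ E)
    {φ : EuclideanSpace ℝ (Fin n) → ℝ} (hφc : Continuous φ) (hφ0 : ∀ x, 0 ≤ φ x)
    (hφn : ∃ x, φ x ≠ 0) (hφE : Integrable fun x => (1 + ‖x‖) ^ E * φ x) {C : ℝ} (hC : 1 ≤ C) :
    ∃ C' : ℝ, 1 ≤ C' ∧ ∀ (x₀ : EuclideanSpace ℝ (Fin n)) (ρ : ℝ), 0 < ρ →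
      ∀ P Q : EuclideanSpace ℝ (Fin n) → ℝ, Continuous P → Continuous Q →
      (∀ x, 0 ≤ P x) → (∀ x, 0 ≤ Q x) →
      (∀ y, ∫⁻ x, ENNReal.ofReal (φ (ρ⁻¹ • (x - y)) * P x) ≤
        ENNReal.ofReal C * ∫⁻ x, ENNReal.ofReal (φ (ρ⁻¹ • (x - y)) * Q x)) →
      ∫⁻ x, ENNReal.ofReal (ballWeight E x₀ ρ x * P x) ≤
        ENNReal.ofReal C' * ∫⁻ x, ENNReal.ofReal (ballWeight E x₀ ρ x * Q x) := by
  -- The hypothesis is integrated in `y` against `w y`. The average of `w y * φ(ρ⁻¹(x - y))` over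
  -- `y` lies between `ρ^n * A * w x` and `ρ^n * B * w x`, where `A` and `B` are the integrals of
  -- `hm` and `hp`; the loss is `B / A`.
  set hp : EuclideanSpace ℝ (Fin n) → ℝ := fun z => (1 + ‖z‖) ^ E * φ z with hhp
  set hm : EuclideanSpace ℝ (Fin n) → ℝ := fun z => (1 + ‖z‖) ^ (-E) * φ z with hhm
  have hp0 : ∀ z, 0 ≤ hp z := fun z => mul_nonneg (Real.rpow_nonneg (by positivity) _) (hφ0 z)
  have hm0 : ∀ z, 0 ≤ hm z := fun z => mul_nonneg (Real.rpow_nonneg (by positivity) _) (hφ0 z)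
  have hmc : Continuous hm :=
    (Continuous.rpow_const (by fun_prop) fun x => Or.inl (by positivity)).mul hφc
  have hmp : ∀ z, hm z ≤ hp z := fun z => mul_le_mul_of_nonneg_right
    (Real.rpow_le_rpow_of_exponent_le (by linarith [norm_nonneg z]) (by linarith)) (hφ0 z)
  have hmi : Integrable hm := hφE.mono' hmc.aestronglyMeasurable (ae_of_all _ fun z => by
    rw [Real.norm_of_nonneg (hm0 z)]; exact hmp z)
  have hA : 0 < ∫ z, hm z := by
    obtain ⟨z, hz⟩ := hφn
    refine integral_pos_of_integrable_nonneg_nonzero hmc hmi hm0 (x := z) ?_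
    exact mul_ne_zero (Real.rpow_pos_of_pos (by positivity) _).ne' hz
  have hAB : ∫ z, hm z ≤ ∫ z, hp z := integral_mono hmi hφE hmp
  set A := ∫ z, hm z with hAdef
  set B := ∫ z, hp z with hBdef
  refine ⟨C * (B / A), one_le_mul_of_one_le_of_one_le hC ((one_le_div hA).2 hAB), ?_⟩
  intro x₀ ρ hρ P Q hP hQ hP0 hQ0 H
  set w := ballWeight E x₀ ρ with hw
  have hw0 : ∀ x, 0 ≤ w x := ballWeight_nonneg E x₀ hρ
  have hwc : Continuous w := continuous_ballWeight E x₀ hρ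
  have hρn : 0 < ρ ^ n := by positivity
  have hlow : ∀ x, ENNReal.ofReal (ρ ^ n * A) * ENNReal.ofReal (w x * P x) ≤
      ∫⁻ y, ENNReal.ofReal (w y * (φ (ρ⁻¹ • (x - y)) * P x)) := by
    intro x
    rw [← lintegral_ofReal_comp_inv_smul_sub hm0 hmi x hρ, ← lintegral_mul_const' _ _
      ENNReal.ofReal_ne_top]
    refine lintegral_mono fun y => ?_
    rw [← ENNReal.ofReal_mul (hm0 _)]
    refine ENNReal.ofReal_le_ofReal ?_
    have := mul_le_mul_of_nonneg_right (ballWeight_mul_le hE x₀ hρ x y)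
      (mul_nonneg (hφ0 (ρ⁻¹ • (x - y))) (hP0 x))
    refine le_trans (le_of_eq ?_) this
    simp only [hhm]; ring
  have hup : ∀ x, ∫⁻ y, ENNReal.ofReal (w y * (φ (ρ⁻¹ • (x - y)) * Q x)) ≤
      ENNReal.ofReal (ρ ^ n * B) * ENNReal.ofReal (w x * Q x) := by
    intro x
    rw [← lintegral_ofReal_comp_inv_smul_sub hp0 hφE x hρ, ← lintegral_mul_const' _ _
      ENNReal.ofReal_ne_top]
    refine lintegral_mono fun y => ?_
    rw [← ENNReal.ofReal_mul (hp0 _)]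
    refine ENNReal.ofReal_le_ofReal ?_
    have := mul_le_mul_of_nonneg_right (ballWeight_le_mul hE x₀ hρ x y)
      (mul_nonneg (hφ0 (ρ⁻¹ • (x - y))) (hQ0 x))
    refine le_trans this (le_of_eq ?_)
    simp only [hhp]; ring
  have hswap : ∀ T : EuclideanSpace ℝ (Fin n) → ℝ, Continuous T →
      ∫⁻ x, ∫⁻ y, ENNReal.ofReal (w y * (φ (ρ⁻¹ • (x - y)) * T x)) =
      ∫⁻ y, ENNReal.ofReal (w y) * ∫⁻ x, ENNReal.ofReal (φ (ρ⁻¹ • (x - y)) * T x) := by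
    intro T hT
    rw [lintegral_lintegral_swap]
    · refine lintegral_congr fun y => ?_
      rw [← lintegral_const_mul' _ _ ENNReal.ofReal_ne_top]
      refine lintegral_congr fun x => ?_
      rw [ENNReal.ofReal_mul (hw0 y)]
    · refine Measurable.aemeasurable (Continuous.measurable ?_)
      refine ENNReal.continuous_ofReal.comp ?_
      fun_prop
  have hmain : ENNReal.ofReal (ρ ^ n * A) * ∫⁻ x, ENNReal.ofReal (w x * P x) ≤
      ENNReal.ofReal C * (ENNReal.ofReal (ρ ^ n * B) * ∫⁻ x, ENNReal.ofReal (w x * Q x)) := by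
    calc _ = ∫⁻ x, ENNReal.ofReal (ρ ^ n * A) * ENNReal.ofReal (w x * P x) :=
          (lintegral_const_mul' _ _ ENNReal.ofReal_ne_top).symm
      _ ≤ ∫⁻ x, ∫⁻ y, ENNReal.ofReal (w y * (φ (ρ⁻¹ • (x - y)) * P x)) := lintegral_mono hlow
      _ = ∫⁻ y, ENNReal.ofReal (w y) * ∫⁻ x, ENNReal.ofReal (φ (ρ⁻¹ • (x - y)) * P x) :=
          hswap P hP
      _ ≤ ∫⁻ y, ENNReal.ofReal C *
          (ENNReal.ofReal (w y) * ∫⁻ x, ENNReal.ofReal (φ (ρ⁻¹ • (x - y)) * Q x)) :=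
          lintegral_mono fun y => by
            refine (mul_le_mul_right (H y) _).trans_eq ?_
            ring
      _ = ENNReal.ofReal C * ∫⁻ x, ∫⁻ y, ENNReal.ofReal (w y * (φ (ρ⁻¹ • (x - y)) * Q x)) := by
          rw [lintegral_const_mul' _ _ ENNReal.ofReal_ne_top, hswap Q hQ]
      _ ≤ ENNReal.ofReal C * ∫⁻ x, ENNReal.ofReal (ρ ^ n * B) * ENNReal.ofReal (w x * Q x) :=
          mul_le_mul_right (lintegral_mono hup) _
      _ = _ := by rw [lintegral_const_mul' _ _ ENNReal.ofReal_ne_top]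
  have hC0 : 0 ≤ C := by linarith
  have heq : ENNReal.ofReal C * (ENNReal.ofReal (ρ ^ n * B) *
      ∫⁻ x, ENNReal.ofReal (w x * Q x)) = ENNReal.ofReal (ρ ^ n * A) *
      (ENNReal.ofReal (C * (B / A)) * ∫⁻ x, ENNReal.ofReal (w x * Q x)) := by
    rw [← mul_assoc, ← mul_assoc, ← ENNReal.ofReal_mul hC0, ← ENNReal.ofReal_mul (by positivity)]
    congr 2
    field_simp
  rw [heq] at hmain
  have hne : ENNReal.ofReal (ρ ^ n * A) ≠ 0 := by
    rw [Ne, ENNReal.ofReal_eq_zero, not_le]; positivity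
  exact (ENNReal.mul_le_mul_iff_right hne ENNReal.ofReal_ne_top).1 hmain

/-! ### Weighted norms and the conclusion -/

theorem weightedLpNorm_two_mul_eq {n : ℕ} {G : Type*} [NormedAddCommGroup G]
    {F : EuclideanSpace ℝ (Fin n) → G} (hF : Continuous F) {m : ℕ} (hm : 1 ≤ m)
    {v : EuclideanSpace ℝ (Fin n) → ℝ} (hv : Continuous v) (hv0 : ∀ x, 0 ≤ v x) :
    weightedLpNorm F (2 * m) v =
      (∫⁻ x, ENNReal.ofReal (v x * ‖F x‖ ^ (2 * m))) ^ (1 / (2 * m : ℝ)) := by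
  have hp : (2 * (m : ENNReal)).toReal = 2 * m := by simp
  have hm0 : (m : ENNReal) ≠ 0 := by simp; omega
  rw [weightedLpNorm, eLpNorm_eq_lintegral_rpow_enorm_toReal (mul_ne_zero two_ne_zero hm0)
    (ENNReal.mul_ne_top (by simp) (by simp)), hp,
    lintegral_withDensity_eq_lintegral_mul _ (hv.measurable.ennreal_ofReal)
      (hF.enorm.measurable.pow_const _)]
  congr 1
  refine lintegral_congr fun x => ?_
  rw [Pi.mul_apply, ENNReal.ofReal_mul (hv0 x), ENNReal.ofReal_pow (norm_nonneg _), ofReal_norm]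
  congr 1
  rw [← ENNReal.rpow_natCast]
  push_cast
  rfl

/-- Minkowski's inequality in `L^p` for the functions `|F i|^2`; it yields decoupling from the
square function estimate. -/
theorem eLpNorm_sqrt_sum_sq_le {X : Type*} [MeasurableSpace X] {μ : Measure X} {ι : Type*}
    (s : Finset ι) {F : ι → X → ℂ} (hF : ∀ i, AEStronglyMeasurable (F i) μ) {p : ENNReal}
    (hp : 1 ≤ p) :
    eLpNorm (fun x => √(∑ i ∈ s, ‖F i x‖ ^ 2)) (2 * p) μ ≤
      (∑ i ∈ s, eLpNorm (F i) (2 * p) μ ^ 2) ^ (1 / 2 : ℝ) := by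
  have h2 : ∀ {G : Type} [NormedAddCommGroup G] (g : X → G),
      eLpNorm (fun x => ‖g x‖ ^ 2) p μ = eLpNorm g (2 * p) μ ^ 2 := by
    intro G _ g
    have := eLpNorm_norm_rpow (p := p) (μ := μ) g (q := 2) two_pos
    simpa [mul_comm] using this
  have h3 := eLpNorm_sum_le (μ := μ) (s := s) (f := fun i x => ‖F i x‖ ^ 2)
    (fun i _ => (hF i).norm.pow 2) hp
  have h4 : (∑ i ∈ s, fun x => ‖F i x‖ ^ 2) = fun x => ‖√(∑ i ∈ s, ‖F i x‖ ^ 2)‖ ^ 2 := by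
    ext x
    rw [Real.norm_of_nonneg (Real.sqrt_nonneg _), Real.sq_sqrt
      (Finset.sum_nonneg fun _ _ => by positivity), Finset.sum_apply]
  rw [h4, h2] at h3
  simp only [h2] at h3
  rw [one_div, ENNReal.le_rpow_inv_iff two_pos]
  simpa using h3

/-- The square function estimate and the decoupling inequality for a continuous curve with the
matching property. -/
theorem squareFunction_decoupling_of_continuous {n : ℕ} (hn : 1 ≤ n)
    {γ : ℝ → EuclideanSpace ℝ (Fin n)} (hγ : Continuous γ) {C δ : ℝ} (hC : 0 < C) (hδ : 0 < δ)
    (hmatch : HasMatching γ C δ) {E : ℝ} (hE : 0 ≤ E) :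
    ∃ C : ℝ, 0 < C ∧ ∀ m : ℕ, 1 ≤ m → m ≤ n → ∀ R : ℝ, 1 ≤ R →
      ∀ (x₀ : EuclideanSpace ℝ (Fin n)) (ρ : ℝ), R ^ n ≤ ρ →
      ∀ f : ℝ → ℂ, IntegrableOn f (Icc 0 1) →
        weightedLpNorm (extensionOp γ (Icc 0 1) f) (2 * m) (ballWeight E x₀ ρ) ≤
            ENNReal.ofReal C *
              weightedLpNorm (squareFunction γ R f) (2 * m) (ballWeight E x₀ ρ) ∧
        weightedLpNorm (extensionOp γ (Icc 0 1) f) (2 * m) (ballWeight E x₀ ρ) ≤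
            ENNReal.ofReal C *
              (∑ l ∈ Finset.range ⌈R⌉₊,
                weightedLpNorm (extensionOp γ (dissectionInterval R l) f) (2 * m)
                  (ballWeight E x₀ ρ) ^ 2) ^ (1 / 2 : ℝ) := by
  obtain ⟨φ, hφc, hφ0, hφn, hφE, r, hr, hφr⟩ := exists_band_limited_weight n E
  have hφi : Integrable φ := hφE.mono' hφc.aestronglyMeasurable (ae_of_all _ fun x => by
    rw [Real.norm_of_nonneg (hφ0 x)]
    exact le_mul_of_one_le_left (hφ0 x)
      (Real.one_le_rpow (by linarith [norm_nonneg x]) hE))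
  obtain ⟨C₁, hC₁, H₁⟩ := hmatch.integral_norm_extensionOp_pow_le hn hγ hC hδ hφ0 hφi hr hφr
  obtain ⟨C₂, hC₂, H₂⟩ := lintegral_ballWeight_mul_le hE hφc hφ0 hφn hφE hC₁
  refine ⟨C₂, by linarith, fun m hm hmn R hR x₀ ρ hρ f hf => ?_⟩
  have hρ0 : 0 < ρ := lt_of_lt_of_le (by positivity) hρ
  have hfl : ∀ l, IntegrableOn f (dissectionInterval R l) := fun l =>
    hf.mono_set (dissectionInterval_subset R l)
  have hEc : Continuous (extensionOp γ (Icc 0 1) f) := continuous_extensionOp hγ hf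
  have hFc : ∀ l, Continuous (extensionOp γ (dissectionInterval R l) f) := fun l =>
    continuous_extensionOp hγ (hfl l)
  have hSc : Continuous (squareFunction γ R f) := by
    unfold squareFunction
    fun_prop
  have hS0 : ∀ x, 0 ≤ squareFunction γ R f x := fun x => Real.sqrt_nonneg _
  have hEM : ∀ x, ‖extensionOp γ (Icc 0 1) f x‖ ≤ ∫ t in Icc 0 1, ‖f t‖ :=
    norm_extensionOp_le _ _ _
  have hSM : ∀ x, squareFunction γ R f x ≤
      √(∑ l ∈ Finset.range ⌈R⌉₊, (∫ t in dissectionInterval R l, ‖f t‖) ^ 2) := fun x =>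
    Real.sqrt_le_sqrt (Finset.sum_le_sum fun l _ =>
      pow_le_pow_left₀ (norm_nonneg _) (norm_extensionOp_le _ _ _ _) 2)
  have hweighted := H₂ x₀ ρ hρ0 (fun x => ‖extensionOp γ (Icc 0 1) f x‖ ^ (2 * m))
    (fun x => squareFunction γ R f x ^ (2 * m)) (by fun_prop) (by fun_prop)
    (fun x => by positivity) (fun x => pow_nonneg (hS0 x) _) (by
      intro y
      have hWi : Integrable fun x => φ (ρ⁻¹ • (x - y)) :=
        (hφi.comp_smul (inv_ne_zero hρ0.ne')).comp_sub_right y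
      rw [← ofReal_integral_eq_lintegral_ofReal, ← ofReal_integral_eq_lintegral_ofReal,
        ← ENNReal.ofReal_mul (by linarith)]
      · exact ENNReal.ofReal_le_ofReal (H₁ m hm hmn R ρ hR hρ y f hf)
      · refine hWi.mul_bdd (c := (√(∑ l ∈ Finset.range ⌈R⌉₊,
          (∫ t in dissectionInterval R l, ‖f t‖) ^ 2)) ^ (2 * m))
          (Continuous.aestronglyMeasurable (by fun_prop)) (ae_of_all _ fun x => ?_)
        rw [norm_pow, Real.norm_of_nonneg (hS0 x)]
        exact pow_le_pow_left₀ (hS0 x) (hSM x) _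
      · exact ae_of_all _ fun x => mul_nonneg (hφ0 _) (pow_nonneg (hS0 x) _)
      · refine hWi.mul_bdd (c := (∫ t in Icc 0 1, ‖f t‖) ^ (2 * m))
          (Continuous.aestronglyMeasurable (by fun_prop)) (ae_of_all _ fun x => ?_)
        rw [norm_pow, norm_norm]
        exact pow_le_pow_left₀ (norm_nonneg _) (hEM x) _
      · exact ae_of_all _ fun x => mul_nonneg (hφ0 _) (by positivity))
  have hw0 := ballWeight_nonneg E x₀ hρ0
  have hwc := continuous_ballWeight E x₀ hρ0
  have hm0 : (0 : ℝ) < 2 * m := by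
    have : (1 : ℝ) ≤ m := by exact_mod_cast hm
    linarith
  have hfirst : weightedLpNorm (extensionOp γ (Icc 0 1) f) (2 * m) (ballWeight E x₀ ρ) ≤
      ENNReal.ofReal C₂ * weightedLpNorm (squareFunction γ R f) (2 * m) (ballWeight E x₀ ρ) := by
    rw [weightedLpNorm_two_mul_eq hEc hm hwc hw0, weightedLpNorm_two_mul_eq hSc hm hwc hw0]
    simp only [fun x => Real.norm_of_nonneg (hS0 x)]
    refine (ENNReal.rpow_le_rpow hweighted (by positivity)).trans ?_
    rw [ENNReal.mul_rpow_of_nonneg _ _ (by positivity)]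
    refine mul_le_mul_left ?_ _
    -- Because `C₂ ≥ 1`, its root of order `2m` is at most `C₂`, so one constant serves every `m`.
    have h1 : (1 : ENNReal) ≤ ENNReal.ofReal C₂ := by
      rw [← ENNReal.ofReal_one]; exact ENNReal.ofReal_le_ofReal hC₂
    have h2 : 1 / (2 * m : ℝ) ≤ 1 := by
      rw [div_le_one hm0]
      have : (1 : ℝ) ≤ m := by exact_mod_cast hm
      linarith
    simpa using ENNReal.rpow_le_rpow_of_exponent_le h1 h2
  refine ⟨hfirst, hfirst.trans (mul_le_mul_right ?_ _)⟩
  exact eLpNorm_sqrt_sum_sq_le _ (fun l => (hFc l).aestronglyMeasurable) (by exact_mod_cast hm)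

theorem theorem1p2 (n : ℕ) (γ : ℝ → EuclideanSpace ℝ (Fin n)) (hγ : IsNondegenerateCurve γ)
    (E : ℝ) (hE : (n : ℝ) < E) :
    ∃ C : ℝ, 0 < C ∧
      ∀ m : ℕ, 1 ≤ m → m ≤ n →
      ∀ R : ℝ, 1 ≤ R →
      ∀ (x₀ : EuclideanSpace ℝ (Fin n)) (ρ : ℝ), R ^ n ≤ ρ →
      ∀ f : ℝ → ℂ, IntegrableOn f (Icc 0 1) →
        weightedLpNorm (extensionOp γ (Icc 0 1) f) (2 * m) (ballWeight E x₀ ρ) ≤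
            ENNReal.ofReal C *
              weightedLpNorm (squareFunction γ R f) (2 * m) (ballWeight E x₀ ρ) ∧
        weightedLpNorm (extensionOp γ (Icc 0 1) f) (2 * m) (ballWeight E x₀ ρ) ≤
            ENNReal.ofReal C *
              (∑ l ∈ Finset.range ⌈R⌉₊,
                weightedLpNorm (extensionOp γ (dissectionInterval R l) f) (2 * m)
                  (ballWeight E x₀ ρ) ^ 2) ^ (1 / 2 : ℝ) := by
  rcases Nat.eq_zero_or_pos n with hn | hn
  · exact ⟨1, one_pos, fun m hm hmn => by omega⟩
  obtain ⟨C, hC, δ, hδ, hmatch⟩ := hγ.exists_matching hn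
  -- Extending `γ` by its endpoint values makes it continuous on all of `ℝ`, as the measurability
  -- arguments require, and changes neither the operators nor the matching property, which see only
  -- `[0,1]`.
  set γ' : ℝ → EuclideanSpace ℝ (Fin n) := IccExtend zero_le_one ((Icc (0 : ℝ) 1).domRestrict γ)
    with hγ'
  have hγc : Continuous γ' := hγ.contDiffOn.continuousOn.domRestrict.Icc_extend'
  have heq : EqOn γ γ' (Icc 0 1) := fun t ht => by
    rw [hγ', IccExtend_of_mem _ _ ht, domRestrict_apply]
  have hmatch' : HasMatching γ' C δ := by
    intro m hm a b ha hb hab t s ht hs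
    obtain ⟨σ, hσ⟩ := hmatch m hm a b ha hb hab t s ht hs
    have hsub : Icc a b ⊆ Icc 0 1 := Icc_subset_Icc ha hb
    refine ⟨σ, fun i => ?_⟩
    rw [← Finset.sum_congr rfl fun j _ => heq (hsub (ht j)),
      ← Finset.sum_congr rfl fun j _ => heq (hsub (hs j))]
    exact hσ i
  have h1 : ∀ f, extensionOp γ (Icc 0 1) f = extensionOp γ' (Icc 0 1) f := fun f =>
    funext fun x => extensionOp_congr measurableSet_Icc heq f x
  have h2 : ∀ R l f, extensionOp γ (dissectionInterval R l) f =
      extensionOp γ' (dissectionInterval R l) f := fun R l f =>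
    funext fun x => extensionOp_congr (measurableSet_dissectionInterval R l)
      (heq.mono (dissectionInterval_subset R l)) f x
  have h3 : ∀ R f, squareFunction γ R f = squareFunction γ' R f := fun R f => by
    unfold squareFunction
    simp only [h2]
  simp only [h1, h2, h3]
  exact squareFunction_decoupling_of_continuous hn hγc hC hδ hmatch'
    ((Nat.cast_nonneg n).trans hE.le)
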